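/- Let $p$ be a prime and let $g\ge 1$ be an integer. Write $1_g$ for the $g\times g$ identity matrix, $w_g$ for the $g\times g$ matrix with ones on the antidiagonal and zeros elsewhere, and $J=\begin{pmatrix}0&-w_g\\ w_g&0\end{pmatrix}$. For a commutative ring $R$ let $$\mathrm{GSp}_{2g}(R)=\{\gamma\in \mathrm{GL}_{2g}(R): {}^t\gamma J\gamma=\varsigma J \text{ for some } \varsigma\in R^\times\},$$ let $B(R)\subset \mathrm{GSp}_{2g}(R)$ be the subgroup of upper triangular matrices, let $U^{\mathrm{opp}}(R)$ be the subgroup of lower triangular matrices with ones on the diagonal, and let $U_1^{\mathrm{opp}}=\ker\big(U^{\mathrm{opp}}(\mathbb Z_p)\to U^{\mathrm{opp}}(\mathbb Z/p)\big)$. Let $k=(k_1,\dots,k_g)\in\mathbb Z_{>0}^g$ with $k_1\ge\cdots\ge k_g$ (a dominant weight), and put $k(\beta)=\prod_{i=1}^g\beta_{ii}^{k_i}$ for $\beta\in B(\mathbb Q_p)$. Let $V_k$ be the $\mathbb Q_p$-vector space of regular functions $\phi:\mathrm{GSp}_{2g}(\mathbb Q_p)\to\mathbb Q_p$ (polynomials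 in the matrix entries and in $\det^{-1}$) such that $\phi(\gamma\beta)=k(\beta)\phi(\gamma)$ for all $\gamma\in \mathrm{GSp}_{2g}(\mathbb Q_p)$ and $\beta\in B(\mathbb Q_p)$, and let $V_k^\vee=\mathrm{Hom}_{\mathbb Q_p}(V_k,\mathbb Q_p)$. For a $2g\times 2g$ matrix $X$ put $$e_k(X)=\prod_{i=1}^{g}\det\big((X_{ab})_{1\le a,b\le i}\big)^{k_i-k_{i+1}},\qquad k_{g+1}:=0.$$ Then restriction of functions from $\mathrm{GSp}_{2g}(\mathbb Q_p)$ to $U_1^{\mathrm{opp}}$ is injective on $V_k$. For $\mu\in V_k^\vee$ and a function $f$ on $U_1^{\mathrm{opp}}$ that is the restriction of a (then unique) $\phi\in V_k$, write $\int_{U_1^{\mathrm{opp}}}f\,d\mu:=\mu(\phi)$. For $\mu_1,\mu_2\in V_k^\vee$ the iterated integral $$[\mu_1,\mu_2]_k^\circ=\int_{\gamma_2\in U_1^{\mathrm{opp}}}\left(\int_{\gamma_1\in U_1^{\mathrm{opp}}} e_k\!\left({}^t\gamma_2\begin{pmatrix}1_g&0\\0&p^{-1}1_g\end{pmatrix}\gamma_1\right)d\mu_1(\gamma_1)\right)d\mu_2(\gamma_2)$$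 is well defined, i.e. both integrands are restrictions of elements of $V_k$, and $[\cdot,\cdot]_k^\circ$ is a non-degenerate bilinear pairing on $V_k^\vee$: if $[\mu_1,\mu_2]_k^\circ=0$ for all $\mu_2$ then $\mu_1=0$, and if $[\mu_1,\mu_2]_k^\circ=0$ for all $\mu_1$ then $\mu_2=0$. (Here $\begin{pmatrix}1_g&0\\0&p^{-1}1_g\end{pmatrix}={}^tw_p\,J$ with the Atkin–Lehner matrix $w_p=\begin{pmatrix}0&-p^{-1}w_g\\ w_g&0\end{pmatrix}$, so this is the Atkin–Lehner twist of the pairing induced by the symplectic form $J$, restricted to the opposite unipotent.) -/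

import Mathlib

open Matrix

namespace SymplecticPairing

/-- The index set of `2g × 2g` matrices, written in `g × g` blocks. It is ordered
lexicographically: the first block comes before the second one. -/
abbrev Idx (g : ℕ) : Type := Fin g ⊕ Fin g

/-- The `g × g` matrix with ones on the antidiagonal and zeros elsewhere. -/
def antiOne (g : ℕ) (R : Type*) [CommRing R] : Matrix (Fin g) (Fin g) R :=
  Matrix.of fun i j => if j = Fin.rev i then 1 else 0

/-- The Gram matrix of the symplectic pairing. -/
def sympMatrix (g : ℕ) (R : Type*) [CommRing R] : Matrix (Idx g) (Idx g) R :=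
  Matrix.fromBlocks 0 (-antiOne g R) (antiOne g R) 0

/-- The group of symplectic similitudes `GSp_{2g}(R)`. -/
def GSp (g : ℕ) (R : Type*) [CommRing R] : Subgroup (GL (Idx g) R) where
  carrier := {γ | ∃ c : Rˣ, (γ : Matrix (Idx g) (Idx g) R)ᵀ * sympMatrix g R *
    (γ : Matrix (Idx g) (Idx g) R) = (c : R) • sympMatrix g R}
  mul_mem' := by
    rintro a b ⟨c, hc⟩ ⟨d, hd⟩
    refine ⟨c * d, ?_⟩
    calc ((a * b : GL (Idx g) R) : Matrix (Idx g) (Idx g) R)ᵀ * sympMatrix g R *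
          ((a * b : GL (Idx g) R) : Matrix (Idx g) (Idx g) R)
        = (b : Matrix (Idx g) (Idx g) R)ᵀ * ((a : Matrix (Idx g) (Idx g) R)ᵀ *
            sympMatrix g R * (a : Matrix (Idx g) (Idx g) R)) *
            (b : Matrix (Idx g) (Idx g) R) := by
          simp only [Units.val_mul, Matrix.transpose_mul, Matrix.mul_assoc]
      _ = ((c * d : Rˣ) : R) • sympMatrix g R := by
          rw [hc, Matrix.mul_smul, Matrix.smul_mul, hd, smul_smul, Units.val_mul]
  one_mem' := ⟨1, by simp⟩
  inv_mem' := by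
    rintro a ⟨c, hc⟩
    refine ⟨c⁻¹, ?_⟩
    have h1 : (a : Matrix (Idx g) (Idx g) R) *
        ((a⁻¹ : GL (Idx g) R) : Matrix (Idx g) (Idx g) R) = 1 := by
      rw [← Units.val_mul, mul_inv_cancel, Units.val_one]
    have h2 : ((a⁻¹ : GL (Idx g) R) : Matrix (Idx g) (Idx g) R)ᵀ *
        (a : Matrix (Idx g) (Idx g) R)ᵀ = 1 := by
      rw [← Matrix.transpose_mul, h1, Matrix.transpose_one]
    have h3 : sympMatrix g R = (c : R) •
        (((a⁻¹ : GL (Idx g) R) : Matrix (Idx g) (Idx g) R)ᵀ * sympMatrix g R *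
          ((a⁻¹ : GL (Idx g) R) : Matrix (Idx g) (Idx g) R)) := by
      rw [← Matrix.smul_mul, ← Matrix.mul_smul, ← hc]
      simp only [Matrix.mul_assoc, h1, Matrix.mul_one]
      rw [← Matrix.mul_assoc, h2, Matrix.one_mul]
    conv_rhs => rw [h3]
    rw [smul_smul, ← Units.val_mul, inv_mul_cancel, Units.val_one, one_smul]

/-- The matrix underlying an element of `GSp_{2g}(R)`. -/
def mat {g : ℕ} {R : Type*} [CommRing R] (γ : GSp g R) : Matrix (Idx g) (Idx g) R :=
  ((γ : GL (Idx g) R) : Matrix (Idx g) (Idx g) R)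

lemma map_sympMatrix {g : ℕ} {R S : Type*} [CommRing R] [CommRing S] (f : R →+* S) :
    (sympMatrix g R).map f = sympMatrix g S := by
  ext i j
  rcases i with i | i <;> rcases j with j | j <;>
    simp [sympMatrix, antiOne, apply_ite f]

/-- Functoriality of `GSp_{2g}` in the ring. -/
def mapGSp (g : ℕ) {R S : Type*} [CommRing R] [CommRing S] (f : R →+* S) :
    GSp g R →* GSp g S :=
  ((Matrix.GeneralLinearGroup.map f).comp (GSp g R).subtype).codRestrict (GSp g S) (by
    rintro ⟨γ, c, hc⟩
    refine ⟨Units.map f.toMonoidHom c, ?_⟩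
    have h := congrArg (fun M : Matrix (Idx g) (Idx g) R => M.map f) hc
    simp only [Matrix.map_mul, Matrix.transpose_map, map_sympMatrix] at h
    have h' : ((c : R) • sympMatrix g R).map f = f (c : R) • sympMatrix g S := by
      rw [← map_sympMatrix f]
      ext i j
      simp
    rw [h'] at h
    exact h)

/-- The Borel subgroup `B_{GSp_{2g}}(R)` of upper triangular matrices. -/
def Borel (g : ℕ) (R : Type*) [CommRing R] : Set (GSp g R) :=
  {β | ∀ i j : Idx g, toLex j < toLex i → (mat β) i j = 0}

/-- The opposite unipotent radical `U^{opp}_{GSp_{2g}}(R)`: lower triangular matrices with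
ones on the diagonal. -/
def Uopp (g : ℕ) (R : Type*) [CommRing R] : Set (GSp g R) :=
  {u | (∀ i j : Idx g, toLex i < toLex j → (mat u) i j = 0) ∧ ∀ i : Idx g, (mat u) i i = 1}

/-- `U^{opp}_{GSp_{2g},1}`: the kernel of reduction mod `p` on `U^{opp}_{GSp_{2g}}(ℤ_p)`. -/
def UoppOne (p : ℕ) [Fact p.Prime] (g : ℕ) : Set (GSp g ℤ_[p]) :=
  {u | u ∈ Uopp g ℤ_[p] ∧ mapGSp g (PadicInt.toZMod (p := p)) u = 1}

/-- The inclusion of `U^{opp}_{GSp_{2g},1}` into `GSp_{2g}(ℚ_p)`. -/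
noncomputable def inclUopp {p : ℕ} [Fact p.Prime] {g : ℕ} (u : UoppOne p g) :
    GSp g ℚ_[p] :=
  mapGSp g (algebraMap ℤ_[p] ℚ_[p]) u.1

/-- Regular functions on `GSp_{2g}(R)`: polynomials in the matrix entries and in the inverse
of the determinant. -/
def IsRegular {g : ℕ} {R : Type*} [CommRing R] (φ : GSp g R → R) : Prop :=
  ∃ P : MvPolynomial ((Idx g × Idx g) ⊕ Unit) R, ∀ γ : GSp g R,
    φ γ = MvPolynomial.eval (Sum.elim (fun ij : Idx g × Idx g => (mat γ) ij.1 ij.2)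
      (fun _ => Ring.inverse (mat γ).det)) P

/-- The weight `k` evaluated on an upper triangular matrix `β`, through its diagonal:
the product of the `τ_i ^ k_i` for `i = 1, …, g`. -/
def weightChar {g : ℕ} {R : Type*} [CommRing R] (k : Fin g → ℕ) (β : GSp g R) : R :=
  ∏ i : Fin g, (mat β) (Sum.inl i) (Sum.inl i) ^ k i

/-- The representation `V^{alg}_{GSp_{2g},k}` over `ℚ_p`: regular functions `φ` on
`GSp_{2g}(ℚ_p)` with `φ(γβ) = k(β) φ(γ)` for all `β` in the Borel subgroup. -/
def algRep (p : ℕ) [Fact p.Prime] (g : ℕ) (k : Fin g → ℕ) :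
    Submodule ℚ_[p] (GSp g ℚ_[p] → ℚ_[p]) where
  carrier := {φ | IsRegular φ ∧
    ∀ γ β : GSp g ℚ_[p], β ∈ Borel g ℚ_[p] → φ (γ * β) = weightChar k β * φ γ}
  add_mem' := by
    rintro φ ψ ⟨⟨P, hP⟩, hφ⟩ ⟨⟨Q, hQ⟩, hψ⟩
    refine ⟨⟨P + Q, fun γ => ?_⟩, fun γ β hβ => ?_⟩
    · rw [map_add, ← hP, ← hQ]; rfl
    · simp only [Pi.add_apply, hφ γ β hβ, hψ γ β hβ, mul_add]
  zero_mem' := ⟨⟨0, fun γ => by simp⟩, fun γ β _ => by simp⟩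
  smul_mem' := by
    rintro c φ ⟨⟨P, hP⟩, hφ⟩
    refine ⟨⟨MvPolynomial.C c * P, fun γ => ?_⟩, fun γ β hβ => ?_⟩
    · rw [map_mul, MvPolynomial.eval_C, ← hP]; rfl
    · simp only [Pi.smul_apply, hφ γ β hβ, smul_eq_mul]; ring

/-- The linear dual `V^{alg,∨}_{GSp_{2g},k}`. -/
abbrev algRepDual (p : ℕ) [Fact p.Prime] (g : ℕ) (k : Fin g → ℕ) : Type :=
  Module.Dual ℚ_[p] (algRep p g k)

/-- The leading principal `(i+1) × (i+1)` minor of `X`. -/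
def leadingMinor {g : ℕ} {R : Type*} [CommRing R] (X : Matrix (Idx g) (Idx g) R)
    (i : Fin g) : R :=
  (X.submatrix (fun a : Fin (i.1 + 1) => (Sum.inl (Fin.castLE i.2 a) : Idx g))
    (fun a : Fin (i.1 + 1) => (Sum.inl (Fin.castLE i.2 a) : Idx g))).det

/-- The exponents `k_1 - k_2, …, k_{g-1} - k_g, k_g`. The subtraction does not truncate
for a dominant weight. -/
def hstExponent {g : ℕ} (k : Fin g → ℕ) (i : Fin g) : ℕ :=
  k i - if h : i.1 + 1 < g then k ⟨i.1 + 1, h⟩ else 0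

/-- The highest weight vector `e_k^{hst}`, as a function on all matrices. -/
def eHst {g : ℕ} {R : Type*} [CommRing R] (k : Fin g → ℕ) (X : Matrix (Idx g) (Idx g) R) : R :=
  ∏ i : Fin g, leadingMinor X i ^ hstExponent k i

/-- The matrix `diag(1_g, p⁻¹ 1_g)`. -/
noncomputable def twistMatrix (p : ℕ) [Fact p.Prime] (g : ℕ) : Matrix (Idx g) (Idx g) ℚ_[p] :=
  Matrix.fromBlocks 1 0 0 ((p : ℚ_[p])⁻¹ • (1 : Matrix (Fin g) (Fin g) ℚ_[p]))

/-- The Atkin–Lehner matrix `w_p`. -/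
noncomputable def atkinLehner (p : ℕ) [Fact p.Prime] (g : ℕ) : Matrix (Idx g) (Idx g) ℚ_[p] :=
  Matrix.fromBlocks 0 (-((p : ℚ_[p])⁻¹ • antiOne g ℚ_[p])) (antiOne g ℚ_[p]) 0

lemma antiOne_transpose (g : ℕ) (R : Type*) [CommRing R] : (antiOne g R)ᵀ = antiOne g R := by
  ext i j
  simp only [antiOne, Matrix.transpose_apply, Matrix.of_apply]
  congr 1
  rw [eq_iff_iff]
  constructor <;> (rintro rfl; simp)

lemma antiOne_mul_self (g : ℕ) (R : Type*) [CommRing R] : antiOne g R * antiOne g R = 1 := by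
  ext i j
  simp only [antiOne, Matrix.mul_apply, Matrix.of_apply, Matrix.one_apply]
  rw [Finset.sum_eq_single (Fin.rev i)]
  · simp [eq_comm]
  · intro b _ hb
    simp [hb]
  · simp

/-- The matrix `diag(1_g, p⁻¹ 1_g)` is the symplectic form twisted by the Atkin–Lehner matrix. -/
lemma twistMatrix_eq (p : ℕ) [Fact p.Prime] (g : ℕ) :
    twistMatrix p g = (atkinLehner p g)ᵀ * sympMatrix g ℚ_[p] := by
  simp [twistMatrix, atkinLehner, sympMatrix, Matrix.fromBlocks_transpose,
    Matrix.fromBlocks_multiply, antiOne_transpose, antiOne_mul_self]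

/-- Restriction of the functions in `V^{alg}_{GSp_{2g},k}` to `U^{opp}_{GSp_{2g},1}`. -/
noncomputable def restrictUopp (p : ℕ) [Fact p.Prime] (g : ℕ) (k : Fin g → ℕ) :
    algRep p g k →ₗ[ℚ_[p]] (UoppOne p g → ℚ_[p]) where
  toFun φ := fun u => φ.1 (inclUopp u)
  map_add' _ _ := rfl
  map_smul' _ _ := rfl

open Classical in
/-- The integral `∫_{γ ∈ U^{opp}_{GSp_{2g},1}} f(γ) dμ(γ)` for `μ ∈ V^{alg,∨}_{GSp_{2g},k}`:
if `f` is the restriction of some `φ ∈ V^{alg}_{GSp_{2g},k}`, it is `μ φ`; otherwise it is zero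
by convention. -/
noncomputable def integralUopp {p : ℕ} [Fact p.Prime] {g : ℕ} {k : Fin g → ℕ}
    (μ : algRepDual p g k) (f : UoppOne p g → ℚ_[p]) : ℚ_[p] :=
  if h : ∃ φ : algRep p g k, restrictUopp p g k φ = f then μ h.choose else 0

/-- The kernel `(γ₂, γ₁) ↦ e_k^{hst}(γ₂ᵀ diag(1_g, p⁻¹ 1_g) γ₁)`. -/
noncomputable def pairingKernel (p : ℕ) [Fact p.Prime] (g : ℕ) (k : Fin g → ℕ)
    (u₂ u₁ : UoppOne p g) : ℚ_[p] :=
  eHst k ((mat (inclUopp u₂))ᵀ * twistMatrix p g * mat (inclUopp u₁))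

/-- The pairing `[μ₁, μ₂]_k^∘`, the iterated integral of the kernel over
`U^{opp}_{GSp_{2g},1}`, first against `μ₁` and then against `μ₂`. -/
noncomputable def algPairing {p : ℕ} [Fact p.Prime] {g : ℕ} {k : Fin g → ℕ}
    (μ₁ μ₂ : algRepDual p g k) : ℚ_[p] :=
  integralUopp μ₂ fun u₂ => integralUopp μ₁ fun u₁ => pairingKernel p g k u₂ u₁

end SymplecticPairing

open SymplecticPairing

/-!
Write `e` for the highest weight vector `eHst k` and `V` for the representation `algRep p g k`.
The kernel of the pairing is `e(γ₂ᵀ D γ₁)` with `D = diag(1, p⁻¹)`, a symmetric element of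
`GSp`. So the pairing of `μ₁` and `μ₂` is `μ₂(T μ₁)`, where `T μ` is the function
`γ ↦ μ(x ↦ e(γᵀ D x))`, and `T` maps the dual of `V` to `V` (`dualToRep`). A functional `μ` lies in
the left or in the right kernel exactly if it kills all left translates `x ↦ e(h x)`; for the
right kernel this uses `e(Xᵀ) = e(X)`, by which `T` maps evaluation functionals to such translates.
Non-degeneracy therefore means that `V` is spanned by the left translates of `e`
(`mem_hstSpan_padic`). Two facts carry this.

* **Density** (`HasWeight.eq_zero_of_Uopp`). A regular function of weight `k` that vanishes on
  `U^{opp}` is zero. Every element of `GSp` is joined by polynomial curves to elements of the big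
  cell `U^{opp} B`, and a regular function that vanishes at infinitely many points of such a curve
  vanishes on all of it. Contraction by a torus replaces `U^{opp}` by `U^{opp}_1`, which gives the
  injectivity of the restriction map.

* **Generation by `e` over an ordered field** (`mem_hstSpan_of_ordered`). Regular functions are
  evaluations of tensors on the coordinate functions. On tensors of a fixed degree `GSp` acts, and
  for the standard scalar product the adjoint of `h` is `hᵀ`; hence the orthogonal complement of a
  stable subspace is stable. Apply this to the tensors that evaluate into the span of the
  translates of `e`. Take an element of the complement that evaluates to a function of weight `k` with value
  `c` at `1`. Its component of the same weight as `e` under `diag(1, s, s², …)` evaluates to `c e`,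
  because it is constant on `U^{opp}` (`tensorEval_weightComponent_eq`). This component is then
  orthogonal to itself, so it is zero by positivity, and `c = 0`. Translating, every element of
  weight `k` in the complement evaluates to zero.

The field `ℚ_p` carries no ordering, so the second fact is used over `ℚ`. The coordinates of a
regular function over `ℚ_p` in a `ℚ`-basis of `ℚ_p` are regular functions over `ℚ` of the same weight
(`exists_mem_hstSpan_eq_on_subfield`), and a regular function of weight `k` over `ℚ_p` is determined
by its values at rational points (`HasWeight.eq_zero_of_rational`).
-/

namespace SymplecticPairing

/-! ### Elements of the group of symplectic similitudes -/

section Basic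

variable {g : ℕ} {K : Type*} [Field K]

lemma mat_mul (a b : GSp g K) : mat (a * b) = mat a * mat b := rfl

lemma mat_one : mat (1 : GSp g K) = 1 := rfl

lemma mat_inv_mul (a : GSp g K) : mat a⁻¹ * mat a = 1 := by
  rw [← mat_mul, inv_mul_cancel, mat_one]

lemma mat_injective : Function.Injective (mat : GSp g K → Matrix (Idx g) (Idx g) K) :=
  fun _ _ h => Subtype.ext (Units.ext h)

lemma det_mat_ne_zero (a : GSp g K) : (mat a).det ≠ 0 := by
  intro h
  have := congrArg Matrix.det (mat_inv_mul a)
  rw [Matrix.det_mul, h] at this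
  simp at this

lemma sympMatrix_mul_self : sympMatrix g K * sympMatrix g K = -1 := by
  rw [sympMatrix, Matrix.fromBlocks_multiply, ← Matrix.fromBlocks_one, Matrix.fromBlocks_neg]
  simp [antiOne_mul_self]

lemma exists_similitude (a : GSp g K) :
    ∃ c : K, c ≠ 0 ∧ (mat a)ᵀ * sympMatrix g K * mat a = c • sympMatrix g K := by
  obtain ⟨c, hc⟩ := a.2
  exact ⟨c, c.ne_zero, hc⟩

/-- A matrix that multiplies the symplectic form by a non-zero scalar, as an element of `GSp`. -/
def mkGSp (M : Matrix (Idx g) (Idx g) K) (c : K) (hc : c ≠ 0)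
    (h : Mᵀ * sympMatrix g K * M = c • sympMatrix g K) : GSp g K :=
  have h1 : (-(c⁻¹ • (sympMatrix g K * (Mᵀ * sympMatrix g K)))) * M = 1 := by
    rw [Matrix.neg_mul, Matrix.smul_mul, Matrix.mul_assoc, h, Matrix.mul_smul, smul_smul,
      inv_mul_cancel₀ hc, sympMatrix_mul_self]
    simp
  ⟨⟨M, _, mul_eq_one_comm.mp h1, h1⟩, Units.mk0 c hc, h⟩

@[simp]
lemma mat_mkGSp (M : Matrix (Idx g) (Idx g) K) (c : K) (hc : c ≠ 0)
    (h : Mᵀ * sympMatrix g K * M = c • sympMatrix g K) : mat (mkGSp M c hc h) = M := rfl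

/-- `GSp` is stable under transposition. -/
noncomputable def transposeGSp (a : GSp g K) : GSp g K :=
  mkGSp (mat a)ᵀ (exists_similitude a).choose (exists_similitude a).choose_spec.1 (by
    obtain ⟨hc, h⟩ := (exists_similitude a).choose_spec
    set c := (exists_similitude a).choose
    have h1 : (-(c⁻¹ • (sympMatrix g K * ((mat a)ᵀ * sympMatrix g K)))) * mat a = 1 := by
      rw [Matrix.neg_mul, Matrix.smul_mul, Matrix.mul_assoc, h, Matrix.mul_smul, smul_smul,
        inv_mul_cancel₀ hc, sympMatrix_mul_self]
      simp
    have h2 := mul_eq_one_comm.mp h1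
    rw [Matrix.transpose_transpose]
    calc mat a * sympMatrix g K * (mat a)ᵀ
        = c • ((mat a * -(c⁻¹ • (sympMatrix g K * ((mat a)ᵀ * sympMatrix g K)))) *
            sympMatrix g K) := by
          rw [Matrix.mul_neg, Matrix.mul_smul, Matrix.neg_mul, Matrix.smul_mul, smul_neg,
            smul_smul, mul_inv_cancel₀ hc, one_smul]
          simp only [Matrix.mul_assoc, sympMatrix_mul_self]
          simp
      _ = c • sympMatrix g K := by rw [h2, Matrix.one_mul])

@[simp]
lemma mat_transposeGSp (a : GSp g K) : mat (transposeGSp a) = (mat a)ᵀ := rfl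

lemma transposeGSp_mul (a b : GSp g K) :
    transposeGSp (a * b) = transposeGSp b * transposeGSp a :=
  mat_injective (by simp [mat_mul])

lemma transposeGSp_transposeGSp (a : GSp g K) : transposeGSp (transposeGSp a) = a :=
  mat_injective (by simp)

/-- The element `diag(A, c w A⁻ᵀ w)` of the Levi subgroup of the Siegel parabolic. -/
noncomputable def levi (A : Matrix (Fin g) (Fin g) K) (hA : A.det ≠ 0) (c : K) (hc : c ≠ 0) :
    GSp g K :=
  mkGSp (Matrix.fromBlocks A 0 0 (c • (antiOne g K * A⁻¹ᵀ * antiOne g K))) c hc (by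
    have h1 : A⁻¹ * A = 1 := Matrix.nonsing_inv_mul A (isUnit_iff_ne_zero.mpr hA)
    have h2 : Aᵀ * A⁻¹ᵀ = 1 := by rw [← Matrix.transpose_mul, h1, Matrix.transpose_one]
    rw [sympMatrix, Matrix.fromBlocks_transpose, Matrix.fromBlocks_multiply,
      Matrix.fromBlocks_multiply, Matrix.fromBlocks_smul]
    congr 1
    · simp
    · simp only [Matrix.transpose_zero, Matrix.mul_neg, Matrix.zero_mul, add_zero, Matrix.mul_smul,
        Matrix.neg_mul, smul_neg, Matrix.mul_assoc]
      rw [← Matrix.mul_assoc (antiOne g K) (antiOne g K), antiOne_mul_self, Matrix.one_mul,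
        ← Matrix.mul_assoc Aᵀ, h2, Matrix.one_mul]
      simp
    · simp only [Matrix.transpose_smul, Matrix.transpose_mul, Matrix.transpose_transpose,
        antiOne_transpose, Matrix.smul_mul, Matrix.mul_assoc]
      rw [antiOne_mul_self, Matrix.mul_one]
      simp [Matrix.mul_assoc, h1]
    · simp)

/-- The block unipotent matrix with lower left block `X`. -/
def lowerSiegel (X : Matrix (Fin g) (Fin g) K)
    (hX : Xᵀ * antiOne g K = antiOne g K * X) : GSp g K :=
  mkGSp (Matrix.fromBlocks 1 0 X 1) 1 one_ne_zero (by
    rw [sympMatrix, Matrix.fromBlocks_transpose, Matrix.fromBlocks_multiply,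
      Matrix.fromBlocks_multiply]
    simp [hX])

/-- The block unipotent matrix with upper right block `X`. -/
def upperSiegel (X : Matrix (Fin g) (Fin g) K)
    (hX : Xᵀ * antiOne g K = antiOne g K * X) : GSp g K :=
  mkGSp (Matrix.fromBlocks 1 X 0 1) 1 one_ne_zero (by
    rw [sympMatrix, Matrix.fromBlocks_transpose, Matrix.fromBlocks_multiply,
      Matrix.fromBlocks_multiply]
    simp [hX])

/-- The first block column of a symplectic similitude spans a Lagrangian subspace. -/
lemma lagrangian (a : GSp g K) :
    (mat a).toBlocks₁₁ᵀ * antiOne g K * (mat a).toBlocks₂₁ =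
      (mat a).toBlocks₂₁ᵀ * antiOne g K * (mat a).toBlocks₁₁ := by
  obtain ⟨c, -, h⟩ := exists_similitude a
  rw [← Matrix.fromBlocks_toBlocks (mat a), sympMatrix, Matrix.fromBlocks_transpose,
    Matrix.fromBlocks_multiply, Matrix.fromBlocks_multiply, Matrix.fromBlocks_smul] at h
  have h11 := (Matrix.fromBlocks_inj.mp h).1
  simp only [Matrix.mul_zero, Matrix.mul_neg, zero_add, add_zero, Matrix.neg_mul, smul_zero] at h11
  exact (eq_of_sub_eq_zero (by rw [sub_eq_add_neg]; exact h11)).symm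

lemma mem_borel_of_toBlocks {k : Fin g → ℕ} (β : GSp g K) (h11 : (mat β).toBlocks₁₁ = 1)
    (h21 : (mat β).toBlocks₂₁ = 0) : β ∈ Borel g K ∧ weightChar k β = 1 := by
  obtain ⟨c, -, h⟩ := exists_similitude β
  rw [← Matrix.fromBlocks_toBlocks (mat β), sympMatrix, Matrix.fromBlocks_transpose,
    Matrix.fromBlocks_multiply, Matrix.fromBlocks_multiply, Matrix.fromBlocks_smul] at h
  have h12 := (Matrix.fromBlocks_inj.mp h).2.1
  simp only [h11, h21, Matrix.transpose_one, Matrix.transpose_zero, Matrix.mul_zero,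
    Matrix.zero_mul, Matrix.one_mul, zero_add, add_zero, Matrix.neg_mul, Matrix.mul_neg,
    smul_neg, neg_inj] at h12
  have h22 : (mat β).toBlocks₂₂ = c • 1 := by
    have := congrArg (fun M => antiOne g K * M) h12
    simpa [← Matrix.mul_assoc, antiOne_mul_self] using this
  refine ⟨?_, ?_⟩
  · rintro (i | i) (j | j) hij
    · have := congrFun (congrFun h11 i) j
      have hne : i ≠ j := (Sum.Lex.inl_lt_inl_iff.mp hij).ne'
      simpa [Matrix.toBlocks₁₁, hne] using this
    · exact absurd hij Sum.Lex.not_inr_lt_inl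
    · exact congrFun (congrFun h21 i) j
    · have := congrFun (congrFun h22 i) j
      have hne : i ≠ j := (Sum.Lex.inr_lt_inr_iff.mp hij).ne'
      simpa [Matrix.toBlocks₂₂, hne] using this
  · refine Finset.prod_eq_one fun i _ => ?_
    have := congrFun (congrFun h11 i) i
    simp only [Matrix.toBlocks₁₁, Matrix.of_apply, Matrix.one_apply_eq] at this
    rw [this, one_pow]

lemma levi_lower_apply_inr (A : Matrix (Fin g) (Fin g) K) (i j : Fin g) :
    (antiOne g K * A⁻¹ᵀ * antiOne g K) i j = A⁻¹ (Fin.rev j) (Fin.rev i) := by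
  have hrev : ∀ x y : Fin g, y = x.rev ↔ x = y.rev := fun x y => by
    constructor <;> (rintro rfl; simp)
  simp [antiOne, Matrix.mul_apply, hrev _ j]

lemma levi_mem_borel (A : Matrix (Fin g) (Fin g) K) (hA : A.det ≠ 0) (c : K) (hc : c ≠ 0)
    (ht : A.BlockTriangular id) : levi A hA c hc ∈ Borel g K := by
  have := Matrix.invertibleOfIsUnitDet A (isUnit_iff_ne_zero.mpr hA)
  have hinv : A⁻¹.BlockTriangular id := Matrix.blockTriangular_inv_of_blockTriangular ht
  rintro (i | i) (j | j) hij
  · exact ht (Sum.Lex.inl_lt_inl_iff.mp hij)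
  · exact absurd hij Sum.Lex.not_inr_lt_inl
  · rfl
  · have hlt : j < i := Sum.Lex.inr_lt_inr_iff.mp hij
    simp only [levi, mat_mkGSp, Matrix.fromBlocks_apply₂₂, Matrix.smul_apply,
      levi_lower_apply_inr]
    rw [hinv (by simpa using hlt), smul_zero]

lemma mat_lowerSiegel_mul_levi (X : Matrix (Fin g) (Fin g) K)
    (hX : Xᵀ * antiOne g K = antiOne g K * X) (A : Matrix (Fin g) (Fin g) K) (hA : A.det ≠ 0)
    (c : K) (hc : c ≠ 0) :
    mat (lowerSiegel X hX * levi A hA c hc) =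
      Matrix.fromBlocks A 0 (X * A) (c • (antiOne g K * A⁻¹ᵀ * antiOne g K)) := by
  rw [mat_mul, lowerSiegel, levi, mat_mkGSp, mat_mkGSp, Matrix.fromBlocks_multiply]
  simp

lemma det_eq_one_of_lower_unipotent {L : Matrix (Fin g) (Fin g) K}
    (h0 : ∀ i j, i < j → L i j = 0) (h1 : ∀ i, L i i = 1) : L.det = 1 := by
  rw [Matrix.det_of_isLowerTriangular L (fun i j hij => h0 i j hij)]
  simp [h1]

lemma lowerSiegel_mul_levi_mem_Uopp (X : Matrix (Fin g) (Fin g) K)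
    (hX : Xᵀ * antiOne g K = antiOne g K * X) (L : Matrix (Fin g) (Fin g) K) (hL : L.det ≠ 0)
    (h0 : ∀ i j, i < j → L i j = 0) (h1 : ∀ i, L i i = 1) :
    lowerSiegel X hX * levi L hL 1 one_ne_zero ∈ Uopp g K := by
  have := Matrix.invertibleOfIsUnitDet L (isUnit_iff_ne_zero.mpr hL)
  have ht : L.BlockTriangular OrderDual.toDual := fun i j hij => h0 i j hij
  have hinv : L⁻¹.BlockTriangular OrderDual.toDual :=
    Matrix.blockTriangular_inv_of_blockTriangular ht
  have hdiag : ∀ i, L⁻¹ i i = 1 := fun i => by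
    have h2 := congrFun (congrFun (Matrix.nonsing_inv_mul L (isUnit_iff_ne_zero.mpr hL)) i) i
    rw [Matrix.mul_apply, Matrix.one_apply_eq, Finset.sum_eq_single i, h1, mul_one] at h2
    · exact h2
    · intro j _ hj
      rcases lt_or_gt_of_ne hj with hj | hj
      · rw [h0 j i hj, mul_zero]
      · rw [hinv (show OrderDual.toDual j < OrderDual.toDual i from hj), zero_mul]
    · simp
  refine ⟨?_, ?_⟩
  · rintro (i | i) (j | j) hij <;> rw [mat_lowerSiegel_mul_levi]
    · exact h0 i j (Sum.Lex.inl_lt_inl_iff.mp hij)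
    · rfl
    · exact absurd hij Sum.Lex.not_inr_lt_inl
    · have hlt : i < j := Sum.Lex.inr_lt_inr_iff.mp hij
      rw [Matrix.fromBlocks_apply₂₂, Matrix.smul_apply, levi_lower_apply_inr,
        hinv (show OrderDual.toDual (Fin.rev i) < OrderDual.toDual (Fin.rev j) by simpa using hlt),
        smul_zero]
  · rintro (i | i) <;> rw [mat_lowerSiegel_mul_levi]
    · exact h1 i
    · rw [Matrix.fromBlocks_apply₂₂, Matrix.smul_apply, levi_lower_apply_inr, hdiag, one_smul]

/-! ### Functions of a given weight -/

/-- Functions on `GSp` that transform under right translation by the Borel subgroup through the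
character of weight `k`. Regularity is not required. -/
def HasWeight (k : Fin g → ℕ) (φ : GSp g K → K) : Prop :=
  ∀ γ β : GSp g K, β ∈ Borel g K → φ (γ * β) = weightChar k β * φ γ

/-- A function of weight `k` only depends on the Lagrangian frame formed by the first `g`
columns. -/
lemma HasWeight.eq_of_frame_eq {k : Fin g → ℕ} {φ : GSp g K → K} (hφ : HasWeight k φ)
    {a b : GSp g K} (h : ∀ (i : Idx g) (j : Fin g), mat a i (Sum.inl j) = mat b i (Sum.inl j)) :
    φ a = φ b := by
  have hcol : ∀ (i : Idx g) (j : Fin g), mat (a⁻¹ * b) i (Sum.inl j) =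
      (1 : Matrix (Idx g) (Idx g) K) i (Sum.inl j) := fun i j => by
    rw [← mat_inv_mul a, mat_mul, Matrix.mul_apply, Matrix.mul_apply]
    simp only [h]
  obtain ⟨hβ, hk⟩ := mem_borel_of_toBlocks (k := k) (a⁻¹ * b)
    (by ext i j; simp [Matrix.toBlocks₁₁, hcol, Matrix.one_apply])
    (by ext i j; simp [Matrix.toBlocks₂₁, hcol])
  have := hφ a _ hβ
  rwa [mul_inv_cancel_left, hk, one_mul, eq_comm] at this

lemma weightChar_ne_zero_of_levi (k : Fin g → ℕ) (A : Matrix (Fin g) (Fin g) K) (hA : A.det ≠ 0)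
    (c : K) (hc : c ≠ 0) (ht : A.BlockTriangular id) : weightChar k (levi A hA c hc) ≠ 0 := by
  rw [Matrix.det_of_isUpperTriangular ht, Finset.prod_ne_zero_iff] at hA
  exact Finset.prod_ne_zero_iff.mpr fun i hi => pow_ne_zero _ (hA i hi)

/-- The quotient of the lower left block by the upper left block is symmetric for the antidiagonal
form. -/
lemma lagrangian_quotient (a : GSp g K) (hA : (mat a).toBlocks₁₁.det ≠ 0) :
    ((mat a).toBlocks₂₁ * (mat a).toBlocks₁₁⁻¹)ᵀ * antiOne g K =
      antiOne g K * ((mat a).toBlocks₂₁ * (mat a).toBlocks₁₁⁻¹) := by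
  have hl := lagrangian a
  set A := (mat a).toBlocks₁₁
  set C := (mat a).toBlocks₂₁
  have h1 : A * A⁻¹ = 1 := Matrix.mul_nonsing_inv A (isUnit_iff_ne_zero.mpr hA)
  have h2 : A⁻¹ᵀ * Aᵀ = 1 := by rw [← Matrix.transpose_mul, h1, Matrix.transpose_one]
  calc (C * A⁻¹)ᵀ * antiOne g K
      = A⁻¹ᵀ * (Cᵀ * antiOne g K * A) * A⁻¹ := by
        simp only [Matrix.transpose_mul, Matrix.mul_assoc, h1, Matrix.mul_one]
    _ = A⁻¹ᵀ * Aᵀ * (antiOne g K * (C * A⁻¹)) := by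
        rw [← hl]; simp only [Matrix.mul_assoc]
    _ = antiOne g K * (C * A⁻¹) := by rw [h2, Matrix.one_mul]

/-- If `A N` is lower unipotent with `N` upper triangular, where `A` is the upper left block of
`γ`, then `γ` lies in `U^{opp} B`; hence functions of weight `k` vanishing on `U^{opp}` vanish
at `γ`. -/
lemma HasWeight.eq_zero_of_factorization {k : Fin g → ℕ} {φ : GSp g K → K} (hφ : HasWeight k φ)
    (hU : ∀ u ∈ Uopp g K, φ u = 0) (a : GSp g K) (hA : (mat a).toBlocks₁₁.det ≠ 0)
    (N : Matrix (Fin g) (Fin g) K) (hN : N.BlockTriangular id)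
    (h0 : ∀ i j, i < j → ((mat a).toBlocks₁₁ * N) i j = 0)
    (h1 : ∀ i, ((mat a).toBlocks₁₁ * N) i i = 1) : φ a = 0 := by
  have hdet : ((mat a).toBlocks₁₁ * N).det ≠ 0 := by
    rw [det_eq_one_of_lower_unipotent h0 h1]; exact one_ne_zero
  have hNdet : N.det ≠ 0 := by
    rw [Matrix.det_mul] at hdet; exact right_ne_zero_of_mul hdet
  have hframe := hφ.eq_of_frame_eq
    (a := a * levi N hNdet 1 one_ne_zero)
    (b := lowerSiegel _ (lagrangian_quotient a hA) * levi _ hdet 1 one_ne_zero) (by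
      intro i j
      rw [mat_lowerSiegel_mul_levi, mat_mul, ← Matrix.fromBlocks_toBlocks (mat a), levi,
        mat_mkGSp, Matrix.fromBlocks_multiply]
      rw [Matrix.toBlocks_fromBlocks₁₁, Matrix.toBlocks_fromBlocks₂₁]
      have h2 : (mat a).toBlocks₁₁⁻¹ * (mat a).toBlocks₁₁ = 1 :=
        Matrix.nonsing_inv_mul _ (isUnit_iff_ne_zero.mpr hA)
      rcases i with i | i
      · simp
      · rw [← Matrix.mul_assoc, Matrix.mul_assoc _ _ (mat a).toBlocks₁₁, h2]
        simp)
  rw [hφ _ _ (levi_mem_borel N hNdet 1 one_ne_zero hN),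
    hU _ (lowerSiegel_mul_levi_mem_Uopp _ _ _ hdet h0 h1)] at hframe
  exact (mul_eq_zero.mp hframe).resolve_left (weightChar_ne_zero_of_levi _ _ _ _ _ hN)

/-- A matrix with non-zero leading minors becomes lower unipotent after right multiplication
by an upper triangular matrix: the `j`-th column of the latter solves the linear system given by
the `j`-th leading submatrix. -/
lemma exists_upper_mul_eq_lower_unipotent (A : Matrix (Fin g) (Fin g) K)
    (hA : ∀ i : Fin g, (A.submatrix (Fin.castLE i.2 : Fin (i.1 + 1) → Fin g)
      (Fin.castLE i.2)).det ≠ 0) :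
    ∃ N : Matrix (Fin g) (Fin g) K, N.BlockTriangular id ∧
      (∀ i j, i < j → (A * N) i j = 0) ∧ ∀ i, (A * N) i i = 1 := by
  have hlast : ∀ j : Fin g, ∀ i : Fin g, i ≤ j →
      ∃ i' : Fin (j.1 + 1), Fin.castLE j.2 i' = i := fun j i hij =>
    ⟨⟨i.1, Nat.lt_succ_of_le hij⟩, rfl⟩
  let S : ∀ j : Fin g, Matrix (Fin (j.1 + 1)) (Fin (j.1 + 1)) K := fun j =>
    A.submatrix (Fin.castLE j.2) (Fin.castLE j.2)
  let N : Matrix (Fin g) (Fin g) K := Matrix.of fun i j =>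
    if h : i ≤ j then (S j)⁻¹ ⟨i.1, Nat.lt_succ_of_le h⟩ (Fin.last j.1) else 0
  have key : ∀ j : Fin g, ∀ i' : Fin (j.1 + 1),
      (A * N) (Fin.castLE j.2 i') j = (1 : Matrix _ _ K) i' (Fin.last j.1) := by
    intro j i'
    rw [← Matrix.mul_nonsing_inv (S j) (isUnit_iff_ne_zero.mpr (hA j)), Matrix.mul_apply,
      Matrix.mul_apply]
    refine (Finset.sum_of_injOn (Fin.castLE j.2) (Fin.castLE_injective _).injOn (by simp)
      ?_ ?_).symm
    · intro b _ hb
      have : ¬ b ≤ j := fun hbj => hb (by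
        obtain ⟨b', rfl⟩ := hlast j b hbj
        exact ⟨b', by simp, rfl⟩)
      simp [N, this]
    · intro b _
      have : Fin.castLE j.2 b ≤ j := Nat.le_of_lt_succ b.2
      simp [N, this, S]
  refine ⟨N, fun i j hij => ?_, fun i j hij => ?_, fun i => ?_⟩
  · have : ¬ i ≤ j := not_le.mpr hij
    simp [N, this]
  · obtain ⟨i', rfl⟩ := hlast j i hij.le
    rw [key, Matrix.one_apply_ne]
    rintro rfl
    exact absurd hij (lt_irrefl _)
  · exact (key i (Fin.last i.1)).trans (Matrix.one_apply_eq _)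

end Basic

/-! ### Density of the big cell -/

section Density

variable {g : ℕ} {K : Type*} [Field K]

/-- A regular function becomes a polynomial in the matrix entries after multiplication by a power
of the determinant. -/
lemma IsRegular.exists_det_pow_mul {φ : GSp g K → K} (hφ : IsRegular φ) :
    ∃ (m : ℕ) (Q : MvPolynomial (Idx g × Idx g) K), ∀ γ : GSp g K,
      (mat γ).det ^ m * φ γ = MvPolynomial.eval (fun ij => mat γ ij.1 ij.2) Q := by
  obtain ⟨P, hP⟩ := hφ
  simp only [hP]
  clear hP
  let D : MvPolynomial (Idx g × Idx g) K := (Matrix.of fun i j => MvPolynomial.X (i, j)).det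
  have hdet : ∀ (γ : GSp g K) (n : ℕ),
      MvPolynomial.eval (fun ij : Idx g × Idx g => mat γ ij.1 ij.2) (D ^ n) =
      (mat γ).det ^ n := fun γ n => by
    rw [map_pow, RingHom.map_det]
    congr 2
    ext i j
    simp
  induction P using MvPolynomial.induction_on with
  | C a => exact ⟨0, MvPolynomial.C a, fun γ => by simp⟩
  | add P Q hP hQ =>
    obtain ⟨m, P', hP'⟩ := hP
    obtain ⟨n, Q', hQ'⟩ := hQ
    refine ⟨m + n, D ^ n * P' + D ^ m * Q', fun γ => ?_⟩
    simp only [map_add, map_mul, hdet, ← hP', ← hQ']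
    ring
  | mul_X P v hP =>
    obtain ⟨m, P', hP'⟩ := hP
    rcases v with ij | u
    · refine ⟨m, P' * MvPolynomial.X ij, fun γ => ?_⟩
      rw [map_mul, map_mul, ← hP', MvPolynomial.eval_X, MvPolynomial.eval_X, Sum.elim_inl]
      ring
    · refine ⟨m + 1, P', fun γ => ?_⟩
      rw [← hP', map_mul, MvPolynomial.eval_X, Sum.elim_inr, Ring.inverse_eq_inv', pow_succ]
      have := det_mat_ne_zero γ
      field_simp

/-- A regular function that vanishes at infinitely many points of a polynomial curve of matrices
vanishes at every point of `GSp` on that curve. -/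
lemma IsRegular.eq_zero_of_curve {φ : GSp g K → K} (hφ : IsRegular φ)
    (M : Matrix (Idx g) (Idx g) (Polynomial K))
    (h : {s : K | ∃ γ : GSp g K, mat γ = M.map (Polynomial.eval s) ∧ φ γ = 0}.Infinite)
    (γ₀ : GSp g K) (s₀ : K) (h₀ : mat γ₀ = M.map (Polynomial.eval s₀)) : φ γ₀ = 0 := by
  obtain ⟨m, Q, hQ⟩ := hφ.exists_det_pow_mul
  let q : Polynomial K := MvPolynomial.eval₂ Polynomial.C (fun ij => M ij.1 ij.2) Q
  have hq : ∀ (γ : GSp g K) (s : K), mat γ = M.map (Polynomial.eval s) →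
      (mat γ).det ^ m * φ γ = q.eval s := fun γ s hs => by
    have h1 : q.eval s = Polynomial.evalRingHom s q := rfl
    rw [hQ, h1, MvPolynomial.hom_eval₂, MvPolynomial.eval, MvPolynomial.coe_eval₂Hom]
    congr 1
    · ext a; simp
    · ext ij; rw [hs]; rfl
  have hq0 : q = 0 := Polynomial.eq_zero_of_infinite_isRoot _ (h.mono (by
    rintro s ⟨γ, hγ, hφγ⟩
    have := hq γ s hγ
    rw [hφγ, mul_zero] at this
    exact this.symm))
  have := hq γ₀ s₀ h₀
  rw [hq0, Polynomial.eval_zero] at this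
  exact (mul_eq_zero.mp this).resolve_left (pow_ne_zero _ (det_mat_ne_zero γ₀))

lemma infinite_setOf_eval_ne_zero [Infinite K] {q : Polynomial K} (hq : q ≠ 0) :
    {s : K | q.eval s ≠ 0}.Infinite :=
  (Polynomial.finite_setOfPred_isRoot hq).infinite_compl

/-- A Lagrangian subspace can be moved by a block unipotent transformation to one that projects
isomorphically to the first `g` coordinates. The dimension of `ker A` decreases under a suitable
update `A + v (w v)ᵀ C`: for `x` in `ker A`, the vector `C x` is orthogonal to the image of `A`,
so any `v` that pairs non-trivially with `C x` lies outside this image. -/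
lemma exists_det_add_mul_ne_zero (A C : Matrix (Fin g) (Fin g) K)
    (hl : Aᵀ * antiOne g K * C = Cᵀ * antiOne g K * A)
    (hinj : ∀ x, A *ᵥ x = 0 → C *ᵥ x = 0 → x = 0) :
    ∃ S : Matrix (Fin g) (Fin g) K, Sᵀ * antiOne g K = antiOne g K * S ∧
      (A + S * C).det ≠ 0 := by
  induction hn : Module.finrank K (LinearMap.ker A.mulVecLin) using Nat.strong_induction_on
    generalizing A with
  | _ n ih =>
    by_cases hdet : A.det = 0
    swap
    · exact ⟨0, by simp, by simpa using hdet⟩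
    obtain ⟨x, hx0, hx⟩ := Matrix.exists_mulVec_eq_zero_iff.mpr hdet
    have hCx : C *ᵥ x ≠ 0 := fun h => hx0 (hinj x hx h)
    obtain ⟨i, hi⟩ := Function.ne_iff.mp hCx
    let f : Fin g → K := Pi.single i 1
    let v : Fin g → K := antiOne g K *ᵥ f
    have hwv : antiOne g K *ᵥ v = f := by
      simp only [v, Matrix.mulVec_mulVec, antiOne_mul_self, Matrix.one_mulVec]
    have hv : ∀ y, A *ᵥ y ≠ v := fun y hy => hi (by
      have h1 : (C *ᵥ x) i = f ⬝ᵥ (C *ᵥ x) := by simp [f]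
      rw [h1, ← hwv, ← hy, Matrix.mulVec_mulVec,
        ← Matrix.vecMul_transpose (antiOne g K * A) y, ← Matrix.dotProduct_mulVec,
        Matrix.mulVec_mulVec, Matrix.transpose_mul,
        antiOne_transpose, hl, ← Matrix.mulVec_mulVec, hx, Matrix.mulVec_zero,
        dotProduct_zero]
      rfl)
    let S : Matrix (Fin g) (Fin g) K := Matrix.vecMulVec v f
    have hS : Sᵀ * antiOne g K = antiOne g K * S := by
      simp only [S, Matrix.transpose_vecMulVec, Matrix.vecMulVec_mul, Matrix.mul_vecMulVec, hwv]
      rw [← Matrix.mulVec_transpose, antiOne_transpose, hwv]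
    have hA' : ∀ z, (A + S * C) *ᵥ z = 0 → A *ᵥ z = 0 ∧ (C *ᵥ z) i = 0 := fun z hz => by
      rw [Matrix.add_mulVec, ← Matrix.mulVec_mulVec, Matrix.vecMulVec_mulVec] at hz
      have h1 : f ⬝ᵥ (C *ᵥ z) = (C *ᵥ z) i := by simp [f]
      rw [h1] at hz
      by_cases ht : (C *ᵥ z) i = 0
      · rw [ht] at hz
        exact ⟨by simpa using hz, ht⟩
      · refine absurd ?_ (hv (-((C *ᵥ z) i)⁻¹ • z))
        rw [Matrix.mulVec_smul, eq_neg_of_add_eq_zero_left hz]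
        ext j
        simp only [Pi.smul_apply, Pi.neg_apply, smul_eq_mul, MulOpposite.smul_eq_mul_unop,
          MulOpposite.unop_op]
        field_simp
    obtain ⟨S', hS', hdet'⟩ := ih _ (by
      rw [← hn]
      refine Submodule.finrank_lt_finrank_of_lt (lt_of_le_of_ne (fun z hz => ?_) fun heq => ?_)
      · exact (hA' z hz).1
      · have hxm : x ∈ LinearMap.ker (A + S * C).mulVecLin := by
          rw [heq]; exact hx
        exact hi (hA' x hxm).2) (A + S * C) (by
      rw [Matrix.transpose_add, Matrix.transpose_mul, Matrix.add_mul, Matrix.add_mul,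
        Matrix.mul_add, hl]
      congr 1
      rw [Matrix.mul_assoc Cᵀ Sᵀ, hS]
      simp only [Matrix.mul_assoc]) (fun z hz hz' => hinj z (hA' z hz).1 hz') rfl
    refine ⟨S + S', ?_, ?_⟩
    · rw [Matrix.transpose_add, Matrix.add_mul, Matrix.mul_add, hS, hS']
    · rwa [Matrix.add_mul, ← add_assoc]

lemma map_eval_map_C {m n : Type*} (M : Matrix m n K) (s : K) :
    (M.map Polynomial.C).map (Polynomial.eval s) = M := by
  ext i j; simp

variable [Infinite K]

/-- Vanishing on `U^{opp}` propagates to all `γ` with invertible upper left block `A`, along the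
curve on which `A` moves linearly to the identity matrix. -/
lemma HasWeight.eq_zero_of_det_ne_zero {k : Fin g → ℕ} {φ : GSp g K → K}
    (hφ : HasWeight k φ) (hreg : IsRegular φ) (hU : ∀ u ∈ Uopp g K, φ u = 0) (a : GSp g K)
    (hA : (mat a).toBlocks₁₁.det ≠ 0) : φ a = 0 := by
  set A := (mat a).toBlocks₁₁ with hAdef
  obtain ⟨Y, hY⟩ : ∃ Y, Y = (mat a).toBlocks₂₁ * A⁻¹ := ⟨_, rfl⟩
  have hYs : Yᵀ * antiOne g K = antiOne g K * Y := by rw [hY]; exact lagrangian_quotient a hA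
  let As : K → Matrix (Fin g) (Fin g) K := fun s => 1 + s • (A - 1)
  let Ap : Matrix (Fin g) (Fin g) (Polynomial K) :=
    1 + (Polynomial.X : Polynomial K) • (A - 1).map Polynomial.C
  have hAp : ∀ s, Ap.map (Polynomial.evalRingHom s) = As s := fun s => by
    ext i j
    simp [Ap, As, Matrix.one_apply, apply_ite (Polynomial.eval s)]
  -- The similitude factor `det (As s)` turns the inverse of `As s` into its adjugate, so that the
  -- entries are polynomial in `s`.
  let M : Matrix (Idx g) (Idx g) (Polynomial K) :=
    Matrix.fromBlocks Ap 0 (Y.map Polynomial.C * Ap)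
      (antiOne g (Polynomial K) * Ap.adjugateᵀ * antiOne g (Polynomial K))
  have hM : ∀ s, (hs : (As s).det ≠ 0) →
      mat (lowerSiegel Y hYs * levi (As s) hs (As s).det hs) = M.map (Polynomial.eval s) := by
    intro s hs
    change _ = M.map (Polynomial.evalRingHom s)
    have hw : (antiOne g (Polynomial K)).map (Polynomial.evalRingHom s) = antiOne g K := by
      ext i j; simp [antiOne, apply_ite (Polynomial.eval s)]
    have hadj : (As s).det • (As s)⁻¹ = (As s).adjugate := by
      rw [Matrix.inv_def, smul_smul, Ring.inverse_eq_inv', mul_inv_cancel₀ hs, one_smul]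
    rw [mat_lowerSiegel_mul_levi, Matrix.fromBlocks_map, hAp, Matrix.map_mul, Matrix.map_mul,
      Matrix.map_mul, hw, Matrix.transpose_map, hAp,
      ← RingHom.mapMatrix_apply (Polynomial.evalRingHom s) Ap.adjugate, RingHom.map_adjugate,
      RingHom.mapMatrix_apply, hAp, ← hadj]
    congr 1
    · ext; simp
    · congr 1
      exact (map_eval_map_C Y s).symm
    · simp [Matrix.transpose_smul]
  let D : Polynomial K := Ap.det * ∏ i : Fin g, (Ap.submatrix
    (Fin.castLE i.2 : Fin (i.1 + 1) → Fin g) (Fin.castLE i.2)).det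
  have hD : ∀ s, D.eval s = (As s).det * ∏ i : Fin g, ((As s).submatrix
      (Fin.castLE i.2 : Fin (i.1 + 1) → Fin g) (Fin.castLE i.2)).det := fun s => by
    change Polynomial.evalRingHom s D = _
    simp only [D, map_mul, map_prod, RingHom.map_det, RingHom.mapMatrix_apply, hAp,
      ← Matrix.submatrix_map]
  have hD0 : D ≠ 0 := fun h => by
    have := hD 0
    rw [h] at this
    have h1 : As 0 = 1 := by simp [As]
    rw [h1] at this
    simp [Matrix.submatrix_one _ (Fin.castLE_injective _)] at this
  have h1 : As 1 = A := by simp [As]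
  have hs1 : (As 1).det ≠ 0 := by rwa [h1]
  have hcurve := hreg.eq_zero_of_curve M
    ((infinite_setOf_eval_ne_zero hD0).mono fun s hs => by
      have hs' : D.eval s ≠ 0 := hs
      rw [hD, mul_ne_zero_iff, Finset.prod_ne_zero_iff] at hs'
      obtain ⟨N, hN, hN0, hN1⟩ := exists_upper_mul_eq_lower_unipotent (As s)
        fun i => hs'.2 i (Finset.mem_univ i)
      have hblock : (mat (lowerSiegel Y hYs * levi (As s) hs'.1 (As s).det hs'.1)).toBlocks₁₁ =
          As s := by rw [mat_lowerSiegel_mul_levi, Matrix.toBlocks_fromBlocks₁₁]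
      exact ⟨_, hM s hs'.1, hφ.eq_zero_of_factorization hU _ (by rw [hblock]; exact hs'.1) N hN
        (by rwa [hblock]) (by rwa [hblock])⟩)
    _ 1 (hM 1 hs1)
  -- The curve passes at `s = 1` through an element with the same first block column as `a`.
  rw [← hcurve]
  refine hφ.eq_of_frame_eq fun i j => ?_
  have hYA : Y * A = (mat a).toBlocks₂₁ := by
    rw [hY, Matrix.mul_assoc, Matrix.nonsing_inv_mul _ (isUnit_iff_ne_zero.mpr hA),
      Matrix.mul_one]
  rw [mat_lowerSiegel_mul_levi, h1, hYA]
  rcases i with i | i <;> rfl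

/-- The product of `U^{opp}` and the Borel subgroup is Zariski dense: a regular function of
weight `k` is determined by its restriction to `U^{opp}`. -/
theorem HasWeight.eq_zero_of_Uopp {k : Fin g → ℕ} {φ : GSp g K → K}
    (hφ : HasWeight k φ) (hreg : IsRegular φ) (hU : ∀ u ∈ Uopp g K, φ u = 0) : φ = 0 := by
  funext a
  set A := (mat a).toBlocks₁₁
  set C := (mat a).toBlocks₂₁
  obtain ⟨S, hS, hdet⟩ := exists_det_add_mul_ne_zero A C (lagrangian a) (fun x hA hC => by
    have h1 : mat a *ᵥ Sum.elim x 0 = 0 := by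
      rw [← Matrix.fromBlocks_toBlocks (mat a), Matrix.fromBlocks_mulVec]
      ext i
      rcases i with i | i
      · simpa using congrFun hA i
      · simpa using congrFun hC i
    have h2 : (Sum.elim x 0 : Idx g → K) = 0 := by
      rw [← Matrix.one_mulVec (Sum.elim x 0), ← mat_inv_mul a, ← Matrix.mulVec_mulVec, h1,
        Matrix.mulVec_zero]
    ext i
    exact congrFun h2 (Sum.inl i))
  have hsS : ∀ s : K, (s • S)ᵀ * antiOne g K = antiOne g K * (s • S) := fun s => by
    rw [Matrix.transpose_smul, Matrix.smul_mul, Matrix.mul_smul, hS]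
  let D : Polynomial K :=
    (A.map Polynomial.C + (Polynomial.X : Polynomial K) • (S * C).map Polynomial.C).det
  have hD : ∀ s, D.eval s = (A + (s • S) * C).det := fun s => by
    change Polynomial.evalRingHom s D = _
    rw [RingHom.map_det]
    congr 1
    ext i j
    simp only [RingHom.mapMatrix_apply, Matrix.map_apply, Matrix.add_apply, Matrix.smul_apply,
      Matrix.smul_mul, smul_eq_mul, map_add, Polynomial.coe_evalRingHom, Polynomial.eval_mul,
      Polynomial.eval_C, Polynomial.eval_X]
  have hD0 : D ≠ 0 := fun h => hdet (by
    have := hD 1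
    rw [h, one_smul, Polynomial.eval_zero] at this
    exact this.symm)
  -- The curve `(1 + s S) a`, whose upper left block is `A + s S C`.
  refine hreg.eq_zero_of_curve
    ((mat a).map Polynomial.C + (Polynomial.X : Polynomial K) •
      (Matrix.fromBlocks 0 S 0 0 * mat a).map Polynomial.C)
    ((infinite_setOf_eval_ne_zero hD0).mono fun s hs => ⟨upperSiegel (s • S) (hsS s) * a, ?_, ?_⟩)
    a 0 ?_
  · have h1 : Matrix.fromBlocks 1 (s • S) 0 1 =
        (1 : Matrix (Idx g) (Idx g) K) + s • Matrix.fromBlocks 0 S 0 0 := by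
      rw [← Matrix.fromBlocks_one, Matrix.fromBlocks_smul, Matrix.fromBlocks_add]
      simp
    rw [mat_mul, upperSiegel, mat_mkGSp, h1, Matrix.add_mul, Matrix.one_mul, Matrix.smul_mul]
    ext i j
    simp only [Matrix.map_apply, Matrix.add_apply, Matrix.smul_apply, smul_eq_mul,
      Polynomial.eval_add, Polynomial.eval_mul, Polynomial.eval_C, Polynomial.eval_X]
  · refine hφ.eq_zero_of_det_ne_zero hreg hU _ ?_
    have hs' : D.eval s ≠ 0 := hs
    rw [hD] at hs'
    rwa [mat_mul, upperSiegel, mat_mkGSp, ← Matrix.fromBlocks_toBlocks (mat a),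
      Matrix.fromBlocks_multiply, Matrix.toBlocks_fromBlocks₁₁, Matrix.one_mul]
  · ext i j
    simp

end Density

/-! ### Regular functions as evaluations of tensors -/

section Tensors

variable {g : ℕ} {K : Type*} [Field K]

variable (g K) in
/-- The algebra of regular functions on `GSp`. -/
def regularFunctions : Subalgebra K (GSp g K → K) where
  carrier := {φ | IsRegular φ}
  mul_mem' := by
    rintro φ ψ ⟨P, hP⟩ ⟨Q, hQ⟩
    exact ⟨P * Q, fun γ => by rw [map_mul, ← hP, ← hQ]; rfl⟩
  add_mem' := by
    rintro φ ψ ⟨P, hP⟩ ⟨Q, hQ⟩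
    exact ⟨P + Q, fun γ => by rw [map_add, ← hP, ← hQ]; rfl⟩
  algebraMap_mem' c := ⟨MvPolynomial.C c, fun γ => by simp⟩

lemma const_mem_regularFunctions (c : K) : (fun _ => c) ∈ regularFunctions g K :=
  (regularFunctions g K).algebraMap_mem c

lemma entry_mem_regularFunctions (i j : Idx g) :
    (fun γ : GSp g K => mat γ i j) ∈ regularFunctions g K :=
  ⟨MvPolynomial.X (Sum.inl (i, j)), fun γ => by simp⟩

lemma det_inv_mem_regularFunctions :
    (fun γ : GSp g K => (mat γ).det⁻¹) ∈ regularFunctions g K :=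
  ⟨MvPolynomial.X (Sum.inr ()), fun γ => by simp⟩

lemma sum_mem_regularFunctions {ι : Type*} (s : Finset ι) (f : ι → GSp g K → K)
    (h : ∀ i ∈ s, f i ∈ regularFunctions g K) :
    (fun γ => ∑ i ∈ s, f i γ) ∈ regularFunctions g K := by
  have := (regularFunctions g K).sum_mem h
  rwa [Finset.sum_fn] at this

lemma prod_mem_regularFunctions {ι : Type*} (s : Finset ι) (f : ι → GSp g K → K)
    (h : ∀ i ∈ s, f i ∈ regularFunctions g K) :
    (fun γ => ∏ i ∈ s, f i γ) ∈ regularFunctions g K := by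
  have := (regularFunctions g K).prod_mem h
  rwa [Finset.prod_fn] at this

lemma mul_mem_regularFunctions {φ ψ : GSp g K → K} (hφ : φ ∈ regularFunctions g K)
    (hψ : ψ ∈ regularFunctions g K) : (fun γ => φ γ * ψ γ) ∈ regularFunctions g K :=
  (regularFunctions g K).mul_mem hφ hψ

variable (g) in
/-- Index set of the coordinate functions on `GSp`: the constant function `1` (`none`), the
matrix entries, and the inverse of the determinant. Their span is stable under left
translation. -/
abbrev Coord : Type := Option ((Idx g × Idx g) ⊕ Unit)

/-- The coordinate functions on `GSp`. -/
def coord (γ : GSp g K) : Coord g → K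
  | none => 1
  | some (Sum.inl ij) => mat γ ij.1 ij.2
  | some (Sum.inr _) => (mat γ).det⁻¹

/-- The matrix of left translation by `h` on the coordinate functions. -/
def coordMat (h : GSp g K) : Matrix (Coord g) (Coord g) K
  | none, none => 1
  | some (Sum.inl ij), some (Sum.inl ab) => if ij.2 = ab.2 then mat h ij.1 ab.1 else 0
  | some (Sum.inr _), some (Sum.inr _) => (mat h).det⁻¹
  | _, _ => 0

lemma coord_mul (h γ : GSp g K) (a : Coord g) :
    coord (h * γ) a = ∑ b, coordMat h a b * coord γ b := by
  rw [Fintype.sum_option, Fintype.sum_sum_type, Fintype.sum_prod_type]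
  rcases a with - | ⟨⟨i, j⟩ | u⟩
  · simp [coord, coordMat]
  · simp [coord, coordMat, mat_mul, Matrix.mul_apply]
  · simp [coord, coordMat, mat_mul, mul_comm]

lemma coordMat_transposeGSp (h : GSp g K) (a b : Coord g) :
    coordMat (transposeGSp h) a b = coordMat h b a := by
  rcases a with - | ⟨⟨i, j⟩ | u⟩ <;> rcases b with - | ⟨⟨i', j'⟩ | u'⟩ <;>
    simp [coordMat, eq_comm]

lemma coord_mem_regularFunctions (a : Coord g) :
    (fun γ : GSp g K => coord γ a) ∈ regularFunctions g K := by
  rcases a with - | ⟨ij | u⟩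
  · exact const_mem_regularFunctions 1
  · exact entry_mem_regularFunctions ij.1 ij.2
  · exact det_inv_mem_regularFunctions

lemma coordMat_mem_regularFunctions (a b : Coord g) :
    (fun γ : GSp g K => coordMat γ a b) ∈ regularFunctions g K := by
  rcases a with - | ⟨⟨i, j⟩ | u⟩ <;> rcases b with - | ⟨⟨i', j'⟩ | u'⟩ <;>
    simp only [coordMat]
  case some.inl.some.inl =>
    by_cases h : j = j'
    · simpa only [h, if_true] using entry_mem_regularFunctions i i'
    · simpa only [h, if_false] using const_mem_regularFunctions 0
  case some.inr.some.inr => exact det_inv_mem_regularFunctions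
  case none.none => exact const_mem_regularFunctions 1
  all_goals exact const_mem_regularFunctions 0

variable (g K) in
/-- Tensors of degree `d` on the space of coordinate functions, given by their components. -/
abbrev Tensor (d : ℕ) : Type _ := (Fin d → Coord g) → K

/-- The regular function defined by a tensor, a non-commutative polynomial of degree `d` in the
coordinate functions. -/
def tensorEval (d : ℕ) : Tensor g K d →ₗ[K] (GSp g K → K) where
  toFun F γ := ∑ s, F s * ∏ i, coord γ (s i)
  map_add' F G := by
    ext γ; simp [add_mul, Finset.sum_add_distrib]
  map_smul' c F := by
    ext γ; simp [mul_assoc, Finset.mul_sum]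

lemma tensorEval_apply {d : ℕ} (F : Tensor g K d) (γ : GSp g K) :
    tensorEval d F γ = ∑ s, F s * ∏ i, coord γ (s i) := rfl

lemma isRegular_tensorEval {d : ℕ} (F : Tensor g K d) : IsRegular (tensorEval d F) :=
  sum_mem_regularFunctions _ _ fun _ _ => mul_mem_regularFunctions
    (const_mem_regularFunctions _)
    (prod_mem_regularFunctions _ _ fun _ _ => coord_mem_regularFunctions _)

lemma exists_tensorEval_coord_mul {d : ℕ} (F : Tensor g K d) (a : Coord g) :
    ∃ G : Tensor g K (d + 1), ∀ γ, tensorEval (d + 1) G γ = coord γ a * tensorEval d F γ := by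
  refine ⟨fun s => if s 0 = a then F (Fin.tail s) else 0, fun γ => ?_⟩
  rw [tensorEval_apply, ← (Fin.consEquiv fun _ => Coord g).sum_comp, Fintype.sum_prod_type,
    Finset.sum_eq_single a]
  · simp only [Fin.consEquiv_apply, Fin.cons_zero, if_true, Fin.prod_univ_succ,
      Fin.cons_succ, tensorEval_apply, Finset.mul_sum]
    refine Finset.sum_congr rfl fun s _ => ?_
    rw [show Fin.tail (Fin.consEquiv (fun _ => Coord g) (a, s)) = s from
      Fin.tail_cons (α := fun _ => Coord g) a s]
    ring
  · intro b _ hb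
    simp [hb]
  · simp

lemma exists_tensorEval_eq_of_le {d n : ℕ} (hdn : d ≤ n) (F : Tensor g K d) :
    ∃ G : Tensor g K n, tensorEval n G = tensorEval d F := by
  induction n, hdn using Nat.le_induction with
  | base => exact ⟨F, rfl⟩
  | succ n _ ih =>
    obtain ⟨G, hG⟩ := ih
    obtain ⟨G', hG'⟩ := exists_tensorEval_coord_mul G none
    exact ⟨G', by ext γ; rw [hG', hG]; simp [coord]⟩

lemma IsRegular.exists_tensorEval {φ : GSp g K → K} (hφ : IsRegular φ) :
    ∃ (d : ℕ) (F : Tensor g K d), tensorEval d F = φ := by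
  obtain ⟨P, hP⟩ := hφ
  obtain rfl : φ = _ := funext hP
  clear hP
  induction P using MvPolynomial.induction_on with
  | C a => exact ⟨0, fun _ => a, by ext γ; simp [tensorEval_apply]⟩
  | add P Q hP hQ =>
    obtain ⟨d, F, hF⟩ := hP
    obtain ⟨n, G, hG⟩ := hQ
    obtain ⟨F', hF'⟩ := exists_tensorEval_eq_of_le (le_max_left d n) F
    obtain ⟨G', hG'⟩ := exists_tensorEval_eq_of_le (le_max_right d n) G
    refine ⟨max d n, F' + G', ?_⟩
    rw [map_add, hF', hG', hF, hG]
    ext γ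
    simp only [Pi.add_apply, map_add]
  | mul_X P v hP =>
    obtain ⟨d, F, hF⟩ := hP
    obtain ⟨G, hG⟩ := exists_tensorEval_coord_mul F (some v)
    refine ⟨d + 1, G, ?_⟩
    ext γ
    rw [hG, hF, map_mul, MvPolynomial.eval_X, mul_comm]
    rcases v with ij | u <;> simp [coord]

/-- The action of `h` on tensors that induces left translation by `h` on functions. -/
def translate {d : ℕ} (h : GSp g K) (F : Tensor g K d) : Tensor g K d :=
  fun s => ∑ t, F t * ∏ i, coordMat h (t i) (s i)

lemma tensorEval_translate {d : ℕ} (h : GSp g K) (F : Tensor g K d) (γ : GSp g K) :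
    tensorEval d (translate h F) γ = tensorEval d F (h * γ) := by
  simp only [tensorEval_apply, translate, Finset.sum_mul]
  rw [Finset.sum_comm]
  refine Finset.sum_congr rfl fun t _ => ?_
  simp only [coord_mul, Finset.prod_univ_sum, Fintype.piFinset_univ, Finset.mul_sum,
    Finset.prod_mul_distrib, mul_assoc]

/-- The standard scalar product on tensors is contravariant: transposition of matrices gives the
adjoint. -/
lemma translate_dotProduct {d : ℕ} (h : GSp g K) (F G : Tensor g K d) :
    translate h F ⬝ᵥ G = F ⬝ᵥ translate (transposeGSp h) G := by
  simp only [dotProduct, translate, Finset.sum_mul, Finset.mul_sum, coordMat_transposeGSp]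
  rw [Finset.sum_comm]
  refine Finset.sum_congr rfl fun t _ => Finset.sum_congr rfl fun s _ => by ring

end Tensors

/-! ### The highest weight vector -/

section HighestWeight

variable {g : ℕ} {K : Type*} [Field K]

lemma leadingMinor_mul_of_mem_borel (X : Matrix (Idx g) (Idx g) K) {β : GSp g K}
    (hβ : β ∈ Borel g K) (i : Fin g) :
    leadingMinor (X * mat β) i =
      leadingMinor X i * ∏ j : Fin g, if j ≤ i then mat β (Sum.inl j) (Sum.inl j) else 1 := by
  let f : Fin (i.1 + 1) → Idx g := fun a => Sum.inl (Fin.castLE i.2 a)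
  have hf : Function.Injective f := fun a b h => Fin.castLE_injective _ (Sum.inl_injective h)
  have hsub : (X * mat β).submatrix f f = X.submatrix f f * (mat β).submatrix f f := by
    ext a b
    rw [Matrix.submatrix_apply, Matrix.mul_apply, Matrix.mul_apply]
    refine (Finset.sum_of_injOn f hf.injOn (by simp) ?_ (fun _ _ => rfl)).symm
    rintro (c | c) - hc
    · have hcb : Fin.castLE i.2 b < c := by
        by_contra! hle
        exact hc ⟨⟨c.1, lt_of_le_of_lt hle b.2⟩, by simp, rfl⟩
      rw [hβ (Sum.inl c) (f b) (Sum.Lex.inl_lt_inl_iff.mpr hcb), mul_zero]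
    · rw [hβ (Sum.inr c) (f b) (Sum.Lex.inl_lt_inr _ _), mul_zero]
  have hdet : ((mat β).submatrix f f).det =
      ∏ a : Fin (i.1 + 1), mat β (f a) (f a) :=
    Matrix.det_of_isUpperTriangular fun a b hab => hβ _ _ (Sum.Lex.inl_lt_inl_iff.mpr hab)
  change ((X * mat β).submatrix f f).det = (X.submatrix f f).det * _
  rw [hsub, Matrix.det_mul, hdet]
  congr 1
  rw [← Finset.prod_filter]
  refine Finset.prod_bij (fun a _ => Fin.castLE i.2 a) (fun a _ => ?_)
    (fun a _ b _ h => Fin.castLE_injective _ h) (fun b hb => ?_) (fun _ _ => rfl)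
  · rw [Finset.mem_filter]
    exact ⟨Finset.mem_univ _, Nat.le_of_lt_succ a.2⟩
  · rw [Finset.mem_filter] at hb
    exact ⟨⟨b.1, Nat.lt_succ_of_le hb.2⟩, Finset.mem_univ _, rfl⟩

/-- The exponents of the minors add up to the weight, by telescoping. -/
lemma sum_hstExponent {k : Fin g → ℕ} (hk : Antitone k) (j : Fin g) :
    ∑ i : Fin g, (if j ≤ i then hstExponent k i else 0) = k j := by
  let k' : ℕ → ℕ := fun n => if h : n < g then k ⟨n, h⟩ else 0
  have hk' : ∀ n, k' (n + 1) ≤ k' n := fun n => by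
    by_cases h : n + 1 < g
    · have h' : n < g := by omega
      simp only [k', h, h', dif_pos]
      exact hk (Fin.mk_le_mk.mpr n.le_succ)
    · simp [k', h]
  have htel : ∀ m n, m + n = g → ∑ i ∈ Finset.Ico m g, (k' i - k' (i + 1)) = k' m := by
    intro m n
    induction n generalizing m with
    | zero => rintro rfl; simp [k']
    | succ n ih =>
      intro h
      rw [Finset.sum_eq_sum_Ico_succ_bot (by omega), ih (m + 1) (by omega)]
      exact Nat.sub_add_cancel (hk' m)
  calc ∑ i : Fin g, (if j ≤ i then hstExponent k i else 0)
      = ∑ i : Fin g, (if j.1 ≤ i.1 then k' i.1 - k' (i.1 + 1) else 0) := by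
        refine Finset.sum_congr rfl fun i _ => ?_
        have h : hstExponent k i = k' i.1 - k' (i.1 + 1) := by
          simp only [hstExponent, k', i.2, dif_pos]
        by_cases hji : j ≤ i
        · rw [if_pos hji, if_pos (Fin.le_def.mp hji), h]
        · rw [if_neg hji, if_neg fun h' => hji (Fin.le_def.mpr h')]
    _ = ∑ i ∈ Finset.range g, (if j.1 ≤ i then k' i - k' (i + 1) else 0) :=
        (Finset.sum_range fun i => if j.1 ≤ i then k' i - k' (i + 1) else 0).symm
    _ = ∑ i ∈ Finset.Ico j.1 g, (k' i - k' (i + 1)) := by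
        rw [← Finset.sum_filter]
        refine Finset.sum_congr (Finset.ext fun i => ?_) fun _ _ => rfl
        rw [Finset.mem_filter, Finset.mem_range, Finset.mem_Ico, and_comm]
    _ = k j := by
        rw [htel j.1 (g - j.1) (by omega)]
        simp [k']

lemma eHst_mul_of_mem_borel {k : Fin g → ℕ} (hk : Antitone k) (X : Matrix (Idx g) (Idx g) K)
    {β : GSp g K} (hβ : β ∈ Borel g K) :
    eHst k (X * mat β) = weightChar k β * eHst k X := by
  simp only [eHst, leadingMinor_mul_of_mem_borel X hβ, mul_pow, Finset.prod_mul_distrib,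
    ← Finset.prod_pow, weightChar]
  rw [mul_comm, Finset.prod_comm]
  congr 1
  refine Finset.prod_congr rfl fun j _ => ?_
  rw [← sum_hstExponent hk j, ← Finset.prod_pow_eq_pow_sum]
  refine Finset.prod_congr rfl fun i _ => ?_
  split_ifs <;> simp

lemma eHst_transpose (k : Fin g → ℕ) (X : Matrix (Idx g) (Idx g) K) :
    eHst k Xᵀ = eHst k X := by
  simp only [eHst, leadingMinor]
  refine Finset.prod_congr rfl fun i _ => ?_
  rw [← Matrix.transpose_submatrix, Matrix.det_transpose]

lemma eHst_of_mem_Uopp (k : Fin g → ℕ) {u : GSp g K} (hu : u ∈ Uopp g K) :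
    eHst k (mat u) = 1 := by
  refine Finset.prod_eq_one fun i _ => ?_
  have h : leadingMinor (mat u) i = 1 := by
    refine (Matrix.det_of_isLowerTriangular _ fun a b hab =>
      hu.1 _ _ (Sum.Lex.inl_lt_inl_iff.mpr hab)).trans ?_
    exact Finset.prod_eq_one fun a _ => hu.2 _
  rw [h, one_pow]

/-- The left translate `x ↦ e_k(h x)` of the highest weight vector. -/
def translatedHst (k : Fin g → ℕ) (h : GSp g K) : GSp g K → K := fun γ => eHst k (mat (h * γ))

lemma hasWeight_translatedHst {k : Fin g → ℕ} (hk : Antitone k) (h : GSp g K) :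
    HasWeight k (translatedHst k h) := fun γ β hβ => by
  rw [translatedHst, ← mul_assoc, mat_mul, eHst_mul_of_mem_borel hk _ hβ]
  rfl

lemma isRegular_translatedHst (k : Fin g → ℕ) (h : GSp g K) : IsRegular (translatedHst k h) := by
  refine prod_mem_regularFunctions Finset.univ
    (fun i γ => leadingMinor (mat (h * γ)) i ^ hstExponent k i) fun i _ =>
      (regularFunctions g K).pow_mem (x := fun γ => leadingMinor (mat (h * γ)) i) ?_ _
  simp only [leadingMinor, Matrix.det_apply']
  refine sum_mem_regularFunctions _ _ fun σ _ => mul_mem_regularFunctions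
    (const_mem_regularFunctions _) (prod_mem_regularFunctions _ _ fun a _ => ?_)
  simp only [Matrix.submatrix_apply, mat_mul, Matrix.mul_apply]
  exact sum_mem_regularFunctions _ _ fun b _ => mul_mem_regularFunctions
    (const_mem_regularFunctions _) (entry_mem_regularFunctions _ _)

variable (K) in
/-- The space spanned by the left translates of the highest weight vector. -/
def hstSpan (k : Fin g → ℕ) : Submodule K (GSp g K → K) :=
  Submodule.span K (Set.range (translatedHst k))

lemma hasWeight_of_mem_hstSpan {k : Fin g → ℕ} (hk : Antitone k)
    {φ : GSp g K → K} (hφ : φ ∈ hstSpan K k) : HasWeight k φ := fun γ β hβ => by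
  induction hφ using Submodule.span_induction with
  | mem φ h => obtain ⟨a, rfl⟩ := h; exact hasWeight_translatedHst hk a γ β hβ
  | zero => simp
  | add φ ψ _ _ hφ hψ => rw [Pi.add_apply, hφ, hψ, Pi.add_apply]; ring
  | smul c φ _ hφ => rw [Pi.smul_apply, hφ, Pi.smul_apply, smul_eq_mul, smul_eq_mul]; ring

lemma comp_mul_left_mem_hstSpan {k : Fin g → ℕ} {φ : GSp g K → K} (hφ : φ ∈ hstSpan K k)
    (h : GSp g K) : (fun γ => φ (h * γ)) ∈ hstSpan K k := by
  have := Submodule.mem_map_of_mem (f := LinearMap.funLeft K K (h * ·)) hφ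
  rw [hstSpan, Submodule.map_span] at this
  refine Submodule.span_mono ?_ this
  rintro _ ⟨_, ⟨a, rfl⟩, rfl⟩
  exact ⟨a * h, by ext γ; simp [translatedHst, LinearMap.funLeft_apply, mul_assoc]⟩

/-! ### The contracting torus -/

/-- The position of an index in the ordering of the rows. -/
def position : Idx g → ℕ
  | Sum.inl i => i.1
  | Sum.inr i => g + i.1

lemma position_lt_of_toLex_lt {i j : Idx g} (h : toLex i < toLex j) : position i < position j := by
  rcases i with i | i <;> rcases j with j | j
  · have hij : i < j := Sum.Lex.inl_lt_inl_iff.mp h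
    exact hij
  · exact Nat.lt_add_right _ i.2
  · exact absurd h Sum.Lex.not_inr_lt_inl
  · have hij : i < j := Sum.Lex.inr_lt_inr_iff.mp h
    exact Nat.add_lt_add_left hij g

lemma toLex_lt_of_position_lt {i j : Idx g} (h : position i < position j) :
    toLex i < toLex j := by
  rcases lt_trichotomy (toLex i) (toLex j) with h' | h' | h'
  · exact h'
  · rw [toLex.injective h'] at h; exact absurd h (lt_irrefl _)
  · exact absurd (position_lt_of_toLex_lt h') h.not_gt

/-- The torus element `diag(1, s, s², …)`, a symplectic similitude of factor `s ^ (2g - 1)`. -/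
def torus (g : ℕ) (s : K) (hs : s ≠ 0) : GSp g K :=
  mkGSp (Matrix.diagonal fun i => s ^ position i) (s ^ (2 * g - 1)) (pow_ne_zero _ hs) (by
    ext i j
    rw [Matrix.diagonal_transpose, Matrix.mul_diagonal, Matrix.diagonal_mul, Matrix.smul_apply]
    have h1 : ∀ a b : Fin g, b = a.rev → a.1 + (g + b.1) = 2 * g - 1 := by
      rintro a _ rfl
      rw [Fin.val_rev]
      omega
    rcases i with i | i <;> rcases j with j | j <;>
      simp only [sympMatrix, antiOne, Matrix.fromBlocks_apply₁₁, Matrix.fromBlocks_apply₁₂,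
        Matrix.fromBlocks_apply₂₁, Matrix.fromBlocks_apply₂₂, Matrix.zero_apply, mul_zero,
        zero_mul, Matrix.neg_apply, Matrix.of_apply, position, smul_eq_mul]
    · split_ifs with h
      · rw [← h1 i j h, pow_add]; ring
      · simp
    · split_ifs with h
      · rw [← h1 j i (by rw [h, Fin.rev_rev]), pow_add]; ring
      · simp)

lemma mat_torus (s : K) (hs : s ≠ 0) :
    mat (torus g s hs) = Matrix.diagonal fun i => s ^ position i := rfl

lemma torus_mem_borel (s : K) (hs : s ≠ 0) : torus g s hs ∈ Borel g K := fun i j hij => by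
  rw [mat_torus, Matrix.diagonal_apply_ne]
  rintro rfl
  exact lt_irrefl _ hij

lemma weightChar_torus (k : Fin g → ℕ) (s : K) (hs : s ≠ 0) :
    weightChar k (torus g s hs) = s ^ ∑ i : Fin g, i.1 * k i := by
  rw [weightChar, ← Finset.prod_pow_eq_pow_sum]
  refine Finset.prod_congr rfl fun i _ => ?_
  rw [mat_torus, Matrix.diagonal_apply_eq, ← pow_mul]
  rfl

/-- The matrix `t(X) u t(X)⁻¹` with polynomial entries, for `u` lower triangular and the torus
element `t`. -/
noncomputable def contraction (u : GSp g K) : Matrix (Idx g) (Idx g) (Polynomial K) :=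
  Matrix.of fun i j => Polynomial.C (mat u i j) * Polynomial.X ^ (position i - position j)

lemma mat_torus_conj {u : GSp g K} (hu : u ∈ Uopp g K) (s : K) (hs : s ≠ 0) :
    mat (torus g s hs * u * (torus g s hs)⁻¹) = (contraction u).map (Polynomial.eval s) := by
  have h1 : mat (torus g s hs * u * (torus g s hs)⁻¹) * mat (torus g s hs) =
      mat (torus g s hs) * mat u := by
    rw [← mat_mul, ← mat_mul, inv_mul_cancel_right]
  ext i j
  have h2 := congrFun (congrFun h1 i) j
  rw [mat_torus, Matrix.mul_diagonal, Matrix.diagonal_mul] at h2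
  refine mul_right_cancel₀ (pow_ne_zero (position j) hs) (h2.trans ?_)
  simp only [contraction, Matrix.map_apply, Matrix.of_apply, Polynomial.eval_mul,
    Polynomial.eval_C, Polynomial.eval_pow, Polynomial.eval_X]
  rcases lt_or_ge (position i) (position j) with h | h
  · rw [hu.1 i j (toLex_lt_of_position_lt h)]
    ring
  · rw [mul_assoc, ← pow_add, Nat.sub_add_cancel h, mul_comm]

lemma contraction_eval_zero {u : GSp g K} (hu : u ∈ Uopp g K) :
    (contraction u).map (Polynomial.eval 0) = 1 := by
  ext i j
  simp only [contraction, Matrix.map_apply, Matrix.of_apply, Polynomial.eval_mul,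
    Polynomial.eval_C, Polynomial.eval_pow, Polynomial.eval_X]
  rcases lt_trichotomy (toLex i) (toLex j) with h | h | h
  · rw [hu.1 i j h, zero_mul, Matrix.one_apply_ne]
    rintro rfl; exact lt_irrefl _ h
  · obtain rfl := toLex.injective h
    rw [hu.2, Nat.sub_self, pow_zero, one_mul, Matrix.one_apply_eq]
  · rw [zero_pow (Nat.sub_ne_zero_of_lt (position_lt_of_toLex_lt h)), mul_zero,
      Matrix.one_apply_ne]
    rintro rfl; exact lt_irrefl _ h

lemma contraction_eval_one (u : GSp g K) :
    (contraction u).map (Polynomial.eval 1) = mat u := by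
  ext i j
  simp [contraction]

lemma det_of_mem_Uopp {u : GSp g K} (hu : u ∈ Uopp g K) : (mat u).det = 1 := by
  have h12 : (mat u).toBlocks₁₂ = 0 := by
    ext i j
    exact hu.1 _ _ (Sum.Lex.inl_lt_inr _ _)
  rw [← Matrix.fromBlocks_toBlocks (mat u), h12, Matrix.det_fromBlocks_zero₁₂,
    det_eq_one_of_lower_unipotent (L := (mat u).toBlocks₁₁)
      (fun i j hij => hu.1 _ _ (Sum.Lex.inl_lt_inl_iff.mpr hij))
      fun i => hu.2 _,
    det_eq_one_of_lower_unipotent (L := (mat u).toBlocks₂₂)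
      (fun i j hij => hu.1 _ _ (Sum.Lex.inr_lt_inr_iff.mpr hij))
      fun i => hu.2 _, one_mul]

end HighestWeight

/-! ### Weight components -/

section Weights

variable {g : ℕ} {K : Type*} [Field K]

variable (g) in
/-- The exponent of the determinant of `diag(1, s, s², …)`. -/
def torusDegree : ℕ := ∑ i : Idx g, position i

/-- The weights of the coordinate functions under `diag(1, s, s², …)`, shifted by
`torusDegree g` so as to be non-negative. -/
def coordWeight : Coord g → ℕ
  | none => torusDegree g
  | some (Sum.inl ij) => torusDegree g + position ij.1
  | some (Sum.inr _) => 0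

lemma coord_torus_mul (s : K) (hs : s ≠ 0) (γ : GSp g K) (a : Coord g) :
    s ^ torusDegree g * coord (torus g s hs * γ) a = s ^ coordWeight a * coord γ a := by
  rcases a with - | ⟨⟨i, j⟩ | u⟩
  · rfl
  · simp only [coord, coordWeight, mat_mul, mat_torus, Matrix.diagonal_mul, pow_add]
    ring
  · have h : s ^ torusDegree g ≠ 0 := pow_ne_zero _ hs
    simp only [coord, coordWeight, mat_mul, mat_torus, Matrix.det_mul, Matrix.det_diagonal,
      Finset.prod_pow_eq_pow_sum]
    rw [mul_inv, ← mul_assoc]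
    change s ^ torusDegree g * (s ^ torusDegree g)⁻¹ * _ = _
    rw [mul_inv_cancel₀ h, pow_zero]

/-- The component of weight `n` of a tensor. -/
def weightComponent {d : ℕ} (n : ℕ) (F : Tensor g K d) : Tensor g K d :=
  fun s => if ∑ i, coordWeight (s i) = n then F s else 0

/-- The polynomial in `s` whose values are those of `tensorEval d F` on `diag(1, s, s², …) γ`, up
to a power of `s`. -/
noncomputable def weightPolynomial {d : ℕ} (F : Tensor g K d) (γ : GSp g K) : Polynomial K :=
  ∑ s, Polynomial.C (F s * ∏ i, coord γ (s i)) * Polynomial.X ^ ∑ i, coordWeight (s i)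

lemma coeff_weightPolynomial {d : ℕ} (F : Tensor g K d) (γ : GSp g K) (n : ℕ) :
    (weightPolynomial F γ).coeff n = tensorEval d (weightComponent n F) γ := by
  simp only [weightPolynomial, Polynomial.finsetSum_coeff, Polynomial.coeff_C_mul,
    Polynomial.coeff_X_pow, tensorEval_apply, weightComponent]
  refine Finset.sum_congr rfl fun s _ => ?_
  by_cases h : ∑ i, coordWeight (s i) = n
  · simp [h]
  · simp [h, Ne.symm h]

lemma eval_weightPolynomial {d : ℕ} (F : Tensor g K d) (γ : GSp g K) (s : K) (hs : s ≠ 0) :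
    (weightPolynomial F γ).eval s =
      s ^ (d * torusDegree g) * tensorEval d F (torus g s hs * γ) := by
  simp only [weightPolynomial, Polynomial.eval_finsetSum, Polynomial.eval_mul, Polynomial.eval_C,
    Polynomial.eval_pow, Polynomial.eval_X, tensorEval_apply, Finset.mul_sum]
  refine Finset.sum_congr rfl fun t _ => ?_
  have h : s ^ (d * torusDegree g) * ∏ i, coord (torus g s hs * γ) (t i) =
      s ^ (∑ i, coordWeight (t i)) * ∏ i, coord γ (t i) := by
    rw [mul_comm d, pow_mul, ← Finset.prod_pow_eq_pow_sum, ← Finset.prod_mul_distrib,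
      ← Finset.prod_congr rfl fun i _ => coord_torus_mul s hs γ (t i), Finset.prod_mul_distrib]
    simp
  rw [mul_left_comm, h]
  ring

lemma dotProduct_weightComponent {d : ℕ} (n : ℕ) (F : Tensor g K d) :
    F ⬝ᵥ weightComponent n F = weightComponent n F ⬝ᵥ weightComponent n F := by
  refine Finset.sum_congr rfl fun s _ => ?_
  rw [weightComponent]
  split_ifs <;> simp

variable [Infinite K]

lemma polynomial_eq_of_eval_eq {p q : Polynomial K} (h : ∀ s, s ≠ 0 → p.eval s = q.eval s) :
    p = q := by
  refine Polynomial.eq_of_infinite_eval_eq p q ?_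
  exact ((Set.finite_singleton (0 : K)).infinite_compl).mono fun s hs => h s hs

lemma hasWeight_weightComponent {k : Fin g → ℕ} {d : ℕ} {F : Tensor g K d}
    (hF : HasWeight k (tensorEval d F)) (n : ℕ) :
    HasWeight k (tensorEval d (weightComponent n F)) := fun γ β hβ => by
  rw [← coeff_weightPolynomial, ← coeff_weightPolynomial, ← Polynomial.coeff_C_mul]
  congr 1
  refine polynomial_eq_of_eval_eq fun s hs => ?_
  rw [Polynomial.eval_mul, Polynomial.eval_C, eval_weightPolynomial F _ s hs,
    eval_weightPolynomial F _ s hs, ← mul_assoc, hF _ _ hβ]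
  ring

/-- On `U^{opp}`, conjugation by the torus contracts everything to `1`. Hence the weight component
of a function of weight `k` at the weight of the highest weight vector is constant on `U^{opp}`,
with the value of the function at `1`. -/
lemma tensorEval_weightComponent_of_mem_Uopp {k : Fin g → ℕ} {d : ℕ} {F : Tensor g K d}
    (hF : HasWeight k (tensorEval d F)) {u : GSp g K} (hu : u ∈ Uopp g K) :
    tensorEval d
      (weightComponent (∑ i : Fin g, i.1 * k i + d * torusDegree g) F) u =
      tensorEval d F 1 := by
  let c : Coord g → Polynomial K
    | none => 1
    | some (Sum.inl ij) => contraction u ij.1 ij.2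
    | some (Sum.inr _) => 1
  let q : Polynomial K := ∑ t, Polynomial.C (F t) * ∏ i, c (t i)
  have hq : ∀ (s : K) (γ : GSp g K), mat γ = (contraction u).map (Polynomial.eval s) →
      (mat γ).det = 1 → q.eval s = tensorEval d F γ := fun s γ hγ hdet => by
    have hc : ∀ a, (c a).eval s = coord γ a := by
      rintro (- | ⟨ij | v⟩)
      · simp [c, coord]
      · simp [c, coord, hγ]
      · simp [c, coord, hdet]
    simp only [q, Polynomial.eval_finsetSum, Polynomial.eval_mul, Polynomial.eval_C,
      Polynomial.eval_prod, hc, tensorEval_apply]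
  have hW : weightPolynomial F u =
      q * Polynomial.X ^ (∑ i : Fin g, i.1 * k i + d * torusDegree g) := by
    refine polynomial_eq_of_eval_eq fun s hs => ?_
    have hconj : torus g s hs * u = torus g s hs * u * (torus g s hs)⁻¹ * torus g s hs := by
      rw [inv_mul_cancel_right]
    have hdet : (mat (torus g s hs * u * (torus g s hs)⁻¹)).det = 1 := by
      have h1 : (mat (torus g s hs * u)).det = (mat (torus g s hs)).det := by
        rw [mat_mul, Matrix.det_mul, det_of_mem_Uopp hu, mul_one]
      rw [hconj, mat_mul, Matrix.det_mul] at h1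
      exact mul_right_cancel₀ (det_mat_ne_zero _) (h1.trans (one_mul _).symm)
    rw [eval_weightPolynomial F u s hs, hconj, hF _ _ (torus_mem_borel s hs),
      weightChar_torus, Polynomial.eval_mul, hq s _ (mat_torus_conj hu s hs) hdet]
    simp only [Polynomial.eval_mul, Polynomial.eval_pow, Polynomial.eval_X, pow_add]
    ring
  rw [← coeff_weightPolynomial, hW, Polynomial.coeff_mul_X_pow', if_pos le_rfl, Nat.sub_self,
    Polynomial.coeff_zero_eq_eval_zero]
  exact hq 0 1 (by rw [contraction_eval_zero hu, mat_one]) (by rw [mat_one, Matrix.det_one])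

lemma tensorEval_weightComponent_eq {k : Fin g → ℕ} (hk : Antitone k) {d : ℕ} {F : Tensor g K d}
    (hF : HasWeight k (tensorEval d F)) :
    tensorEval d
      (weightComponent (∑ i : Fin g, i.1 * k i + d * torusDegree g) F) =
      tensorEval d F 1 • translatedHst k 1 := by
  rw [← sub_eq_zero]
  refine HasWeight.eq_zero_of_Uopp (k := k) (fun γ β hβ => ?_) ?_ fun u hu => ?_
  · have h1 := hasWeight_weightComponent hF (∑ i : Fin g, i.1 * k i + d * torusDegree g) γ β hβ
    have h2 := hasWeight_translatedHst hk 1 γ β hβ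
    simp only [Pi.sub_apply, Pi.smul_apply, smul_eq_mul, h1, h2]
    ring
  · exact (regularFunctions g K).sub_mem (isRegular_tensorEval _)
      ((regularFunctions g K).smul_mem (isRegular_translatedHst k 1) _)
  · rw [Pi.sub_apply, tensorEval_weightComponent_of_mem_Uopp hF hu]
    simp [translatedHst, eHst_of_mem_Uopp k hu]

end Weights

/-! ### Generation by the highest weight vector over an ordered field -/

section Ordered

variable {g : ℕ} {K : Type*} [Field K] [LinearOrder K] [IsStrictOrderedRing K]

/-- Orthogonal decomposition for the standard scalar product over an ordered field. -/
lemma exists_orthogonal_decomposition {ι : Type*} [Fintype ι] (W : Submodule K (ι → K))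
    (x : ι → K) : ∃ y ∈ W, ∃ z, (∀ w ∈ W, z ⬝ᵥ w = 0) ∧ x = y + z := by
  let B : LinearMap.BilinForm K (ι → K) := dotProductBilin K K
  have hB : B.IsRefl := fun v w h => (dotProduct_comm w v).trans h
  have hW : Disjoint W (B.orthogonal W) := by
    rw [Submodule.disjoint_def]
    exact fun v hv hv' => dotProduct_self_eq_zero.mp (hv' v hv)
  have hc := (LinearMap.BilinForm.isCompl_orthogonal_iff_disjoint hB).mpr hW
  obtain ⟨y, hy, z, hz, rfl⟩ :=
    Submodule.mem_sup.mp (show x ∈ W ⊔ B.orthogonal W by rw [hc.sup_eq_top]; trivial)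
  exact ⟨y, hy, z, fun w hw => (dotProduct_comm z w).trans (hz w hw), rfl⟩

/-- Over an ordered field, every regular function of weight `k` is a linear combination of left
translates of the highest weight vector. The tensors whose evaluation lies in the span of these
translates have an orthogonal complement that is stable under the group; if a tensor `F` in the
complement takes a non-zero value, then a translate of `F` has a non-zero weight component
that evaluates to a multiple of the highest weight vector, and that component would be orthogonal
to itself. -/
theorem mem_hstSpan_of_ordered {k : Fin g → ℕ} (hk : Antitone k) {φ : GSp g K → K}
    (hreg : IsRegular φ) (hφ : HasWeight k φ) : φ ∈ hstSpan K k := by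
  obtain ⟨d, F, rfl⟩ := hreg.exists_tensorEval
  let W : Submodule K (Tensor g K d) := (hstSpan K k).comap (tensorEval d)
  obtain ⟨F₁, hF₁, F₂, hF₂, rfl⟩ := exists_orthogonal_decomposition W F
  have hw₂ : HasWeight k (tensorEval d F₂) := fun γ β hβ => by
    have h := hφ γ β hβ
    have h₁ := hasWeight_of_mem_hstSpan hk (Submodule.mem_comap.mp hF₁) γ β hβ
    rw [map_add, Pi.add_apply, Pi.add_apply, h₁] at h
    linear_combination h
  -- It remains to see that the complement `F₂` evaluates to zero, by translating each point to `1`.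
  suffices h : tensorEval d F₂ = 0 by
    rw [map_add, h, add_zero]
    exact hF₁
  funext γ
  set F' := translate γ F₂ with hF'
  have hF'w : HasWeight k (tensorEval d F') := fun γ' β hβ => by
    rw [hF', tensorEval_translate, tensorEval_translate, ← mul_assoc, hw₂ _ _ hβ]
  have horth : ∀ G ∈ W, F' ⬝ᵥ G = 0 := fun G hG => by
    rw [hF', translate_dotProduct]
    refine hF₂ _ (Submodule.mem_comap.mpr ?_)
    have h : tensorEval d (translate (transposeGSp γ) G) =
        fun x => tensorEval d G (transposeGSp γ * x) := funext (tensorEval_translate _ _)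
    rw [h]
    exact comp_mul_left_mem_hstSpan (Submodule.mem_comap.mp hG) _
  have hcomp := tensorEval_weightComponent_eq hk hF'w
  set E := weightComponent (∑ i : Fin g, i.1 * k i + d * torusDegree g) F' with hE
  have hEW : E ∈ W := Submodule.mem_comap.mpr (by
    rw [hcomp]
    exact Submodule.smul_mem _ _ (Submodule.subset_span ⟨1, rfl⟩))
  have hE0 : E = 0 := by
    rw [← dotProduct_self_eq_zero, hE, ← dotProduct_weightComponent, ← hE]
    exact horth E hEW
  have h1 := congrFun hcomp 1
  rw [hE0, map_zero, Pi.smul_apply, hF', tensorEval_translate, mul_one] at h1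
  have h2 : translatedHst k (1 : GSp g K) 1 = 1 := by
    refine eHst_of_mem_Uopp k ⟨fun i j hij => ?_, fun i => ?_⟩
    · rw [mul_one, mat_one, Matrix.one_apply_ne]
      rintro rfl
      exact lt_irrefl _ hij
    · rw [mul_one, mat_one, Matrix.one_apply_eq]
  rw [h2, smul_eq_mul, mul_one] at h1
  exact h1.symm

end Ordered

/-! ### Descent of the field of coefficients -/

section Descent

variable {g : ℕ} {K L : Type*} [Field K] [Field L] [Algebra K L]

lemma mat_mapGSp {R S : Type*} [CommRing R] [CommRing S] (f : R →+* S) (γ : GSp g R) :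
    mat (mapGSp g f γ) = (mat γ).map f := rfl

lemma coord_mapGSp (γ : GSp g K) (a : Coord g) :
    coord (mapGSp g (algebraMap K L) γ) a = algebraMap K L (coord γ a) := by
  rcases a with - | ⟨ij | u⟩
  · simp [coord]
  · rfl
  · simp only [coord, map_inv₀, RingHom.map_det]
    rfl

lemma mapGSp_mem_borel {β : GSp g K} (hβ : β ∈ Borel g K) :
    mapGSp g (algebraMap K L) β ∈ Borel g L := fun i j hij => by
  rw [mat_mapGSp, Matrix.map_apply, hβ i j hij, map_zero]

lemma weightChar_mapGSp (k : Fin g → ℕ) (β : GSp g K) :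
    weightChar k (mapGSp g (algebraMap K L) β) = algebraMap K L (weightChar k β) := by
  simp only [weightChar, map_prod, map_pow]
  rfl

lemma eHst_map (k : Fin g → ℕ) (X : Matrix (Idx g) (Idx g) K) :
    eHst k (X.map (algebraMap K L)) = algebraMap K L (eHst k X) := by
  simp only [eHst, leadingMinor, map_prod, map_pow, RingHom.map_det]
  rfl

lemma exists_extension_of_mem_hstSpan {k : Fin g → ℕ} {ψ : GSp g K → K} (hψ : ψ ∈ hstSpan K k) :
    ∃ w ∈ hstSpan L k, ∀ γ, w (mapGSp g (algebraMap K L) γ) = algebraMap K L (ψ γ) := by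
  induction hψ using Submodule.span_induction with
  | mem ψ h =>
    obtain ⟨a, rfl⟩ := h
    refine ⟨_, Submodule.subset_span ⟨mapGSp g (algebraMap K L) a, rfl⟩, fun γ => ?_⟩
    rw [translatedHst, ← map_mul, mat_mapGSp, eHst_map]
    rfl
  | zero => exact ⟨0, Submodule.zero_mem _, fun γ => by simp⟩
  | add ψ ψ' _ _ h h' =>
    obtain ⟨w, hw, hwγ⟩ := h
    obtain ⟨w', hw', hwγ'⟩ := h'
    exact ⟨w + w', Submodule.add_mem _ hw hw', fun γ => by simp [hwγ, hwγ']⟩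
  | smul c ψ _ h =>
    obtain ⟨w, hw, hwγ⟩ := h
    exact ⟨algebraMap K L c • w, Submodule.smul_mem _ _ hw, fun γ => by simp [hwγ]⟩

/-- On the points over an ordered subfield `K`, a regular function of weight `k` over `L` agrees
with a linear combination of translates of the highest weight vector: its coordinates in a
`K`-basis of `L` are regular functions of weight `k` over `K`. -/
lemma exists_mem_hstSpan_eq_on_subfield [LinearOrder K] [IsStrictOrderedRing K]
    {k : Fin g → ℕ} (hk : Antitone k) {φ : GSp g L → L} (hreg : IsRegular φ)
    (hφ : HasWeight k φ) :
    ∃ w ∈ hstSpan L k, ∀ γ : GSp g K,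
      φ (mapGSp g (algebraMap K L) γ) = w (mapGSp g (algebraMap K L) γ) := by
  classical
  obtain ⟨d, F, rfl⟩ := hreg.exists_tensorEval
  let b := Module.Basis.ofVectorSpace K L
  let I := (Finset.univ : Finset (Fin d → Coord g)).biUnion fun s => (b.repr (F s)).support
  let c : _ → Tensor g K d := fun i s => b.repr (F s) i
  have hF : ∀ s, F s = ∑ i ∈ I, c i s • b i := fun s => by
    conv_lhs => rw [← b.linearCombination_repr (F s)]
    rw [Finsupp.linearCombination_apply]
    exact Finsupp.sum_of_support_subset _
      (Finset.subset_biUnion_of_mem (fun s => (b.repr (F s)).support) (Finset.mem_univ s)) _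
      fun i _ => zero_smul _ _
  have heval : ∀ γ : GSp g K, tensorEval d F (mapGSp g (algebraMap K L) γ) =
      ∑ s, (∏ i, coord γ (s i)) • F s := fun γ => by
    simp only [tensorEval_apply, coord_mapGSp, ← map_prod, Algebra.smul_def, mul_comm]
  have hc : ∀ i (γ : GSp g K), tensorEval d (c i) γ =
      b.repr (tensorEval d F (mapGSp g (algebraMap K L) γ)) i := fun i γ => by
    rw [heval, map_sum, Finsupp.finsetSum_apply, tensorEval_apply]
    refine Finset.sum_congr rfl fun s _ => ?_
    rw [map_smul, Finsupp.smul_apply, smul_eq_mul, mul_comm]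
  have hmem : ∀ i, tensorEval d (c i) ∈ hstSpan K k := fun i =>
    mem_hstSpan_of_ordered hk (isRegular_tensorEval _) fun γ β hβ => by
      rw [hc, hc, map_mul, hφ _ _ (mapGSp_mem_borel hβ), weightChar_mapGSp, ← Algebra.smul_def,
        map_smul, Finsupp.smul_apply, smul_eq_mul]
  choose w hw hwγ using fun i => exists_extension_of_mem_hstSpan (L := L) (hmem i)
  refine ⟨∑ i ∈ I, b i • w i, Submodule.sum_mem _ fun i _ => Submodule.smul_mem _ _ (hw i),
    fun γ => ?_⟩
  rw [Finset.sum_apply]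
  simp only [Pi.smul_apply, hwγ, smul_eq_mul]
  rw [heval]
  simp only [tensorEval_apply, map_sum, Finset.mul_sum]
  rw [Finset.sum_comm]
  refine Finset.sum_congr rfl fun s _ => ?_
  rw [hF s, Finset.smul_sum]
  refine Finset.sum_congr rfl fun i _ => ?_
  rw [smul_smul, Algebra.smul_def, mul_comm (∏ _, _), mul_comm]

/-! ### Density of rational points -/

/-- The lower unipotent matrix with the strictly lower triangular part of `N`. -/
def lowerUnipotent (N : Matrix (Fin g) (Fin g) K) : Matrix (Fin g) (Fin g) K :=
  Matrix.of fun i j => if j < i then N i j else if i = j then 1 else 0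

lemma det_lowerUnipotent (N : Matrix (Fin g) (Fin g) K) : (lowerUnipotent N).det = 1 :=
  det_eq_one_of_lower_unipotent
    (fun i j hij => by simp [lowerUnipotent, hij.not_gt, hij.ne]) fun i => by
      simp [lowerUnipotent]

lemma symmetrization_isSymm (Y : Matrix (Fin g) (Fin g) K) :
    (Y + antiOne g K * Yᵀ * antiOne g K)ᵀ * antiOne g K =
      antiOne g K * (Y + antiOne g K * Yᵀ * antiOne g K) := by
  have h : ∀ Z : Matrix (Fin g) (Fin g) K, antiOne g K * (antiOne g K * Z) = Z := fun Z => by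
    rw [← Matrix.mul_assoc, antiOne_mul_self, Matrix.one_mul]
  simp only [Matrix.transpose_add, Matrix.transpose_mul, Matrix.transpose_transpose,
    antiOne_transpose, Matrix.add_mul, Matrix.mul_add, Matrix.mul_assoc, antiOne_mul_self, h,
    Matrix.mul_one]
  exact add_comm _ _

/-- A parametrization of `U^{opp}` by pairs of matrices. -/
noncomputable def uoppParam (x : Matrix (Fin g) (Fin g) K × Matrix (Fin g) (Fin g) K) : GSp g K :=
  lowerSiegel _ (symmetrization_isSymm x.1) *
    levi (lowerUnipotent x.2) (by rw [det_lowerUnipotent]; exact one_ne_zero) 1 one_ne_zero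

lemma mat_uoppParam (x : Matrix (Fin g) (Fin g) K × Matrix (Fin g) (Fin g) K) :
    mat (uoppParam x) = Matrix.fromBlocks (lowerUnipotent x.2) 0
      ((x.1 + antiOne g K * x.1ᵀ * antiOne g K) * lowerUnipotent x.2)
      (antiOne g K * (lowerUnipotent x.2).adjugateᵀ * antiOne g K) := by
  rw [uoppParam, mat_lowerSiegel_mul_levi, Matrix.inv_def, det_lowerUnipotent]
  simp

lemma uoppParam_map (x : Matrix (Fin g) (Fin g) K × Matrix (Fin g) (Fin g) K) :
    uoppParam (x.1.map (algebraMap K L), x.2.map (algebraMap K L)) =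
      mapGSp g (algebraMap K L) (uoppParam x) := by
  apply mat_injective
  have hw : (antiOne g K).map (algebraMap K L) = antiOne g L := by
    ext i j; simp [antiOne, apply_ite (algebraMap K L)]
  have hN : (lowerUnipotent x.2).map (algebraMap K L) =
      lowerUnipotent (x.2.map (algebraMap K L)) := by
    ext i j; simp [lowerUnipotent, apply_ite (algebraMap K L)]
  have hadj : (lowerUnipotent x.2).adjugate.map (algebraMap K L) =
      (lowerUnipotent (x.2.map (algebraMap K L))).adjugate := by
    rw [← hN]
    exact RingHom.map_adjugate _ _
  rw [mat_mapGSp, mat_uoppParam, mat_uoppParam, Matrix.fromBlocks_map]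
  congr 1
  · exact hN.symm
  · ext; simp
  · rw [Matrix.map_mul, hN, Matrix.map_add _ (map_add _), Matrix.map_mul, Matrix.map_mul, hw,
      Matrix.transpose_map]
  · rw [Matrix.map_mul, Matrix.map_mul, hw, Matrix.transpose_map, hadj]

lemma HasWeight.exists_uoppParam_eq [CharZero K] {k : Fin g → ℕ} {φ : GSp g K → K}
    (hφ : HasWeight k φ) {u : GSp g K} (hu : u ∈ Uopp g K) : ∃ x, φ u = φ (uoppParam x) := by
  set A := (mat u).toBlocks₁₁ with hA
  set C := (mat u).toBlocks₂₁ with hC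
  have hAdet : A.det = 1 := det_eq_one_of_lower_unipotent
    (fun i j hij => hu.1 _ _ (Sum.Lex.inl_lt_inl_iff.mpr hij)) fun i => hu.2 _
  have hAne : A.det ≠ 0 := by rw [hAdet]; exact one_ne_zero
  obtain ⟨Y, hY⟩ : ∃ Y, Y = C * A⁻¹ := ⟨_, rfl⟩
  have hYs : Yᵀ * antiOne g K = antiOne g K * Y := by rw [hY]; exact lagrangian_quotient u hAne
  have hYw : antiOne g K * Yᵀ * antiOne g K = Y := by
    rw [Matrix.mul_assoc, hYs, ← Matrix.mul_assoc, antiOne_mul_self, Matrix.one_mul]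
  have hN : lowerUnipotent A = A := by
    ext i j
    rcases lt_trichotomy j i with h | h | h
    · simp [lowerUnipotent, h]
    · subst h
      have h1 : A j j = 1 := hu.2 (Sum.inl j)
      simp [lowerUnipotent, h1]
    · have h1 : A i j = 0 := hu.1 _ _ (Sum.Lex.inl_lt_inl_iff.mpr h)
      simp [lowerUnipotent, h.not_gt, h.ne, h1]
  refine ⟨((2 : K)⁻¹ • Y, A), hφ.eq_of_frame_eq fun i j => ?_⟩
  have h2 : ((2 : K)⁻¹ • Y + antiOne g K * ((2 : K)⁻¹ • Y)ᵀ * antiOne g K) * A = C := by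
    rw [Matrix.transpose_smul, Matrix.mul_smul, Matrix.smul_mul, hYw, ← add_smul,
      ← two_mul, mul_inv_cancel₀ two_ne_zero, one_smul, hY, Matrix.mul_assoc,
      Matrix.nonsing_inv_mul _ (isUnit_iff_ne_zero.mpr hAne), Matrix.mul_one]
  rw [mat_uoppParam, hN, h2]
  rcases i with i | i <;> rfl

end Descent

section Padic

variable {p : ℕ} [Fact p.Prime] {g : ℕ}

/-- A regular function of weight `k` over `ℚ_p` is determined by its values at rational points. -/
lemma HasWeight.eq_zero_of_rational {k : Fin g → ℕ} {φ : GSp g ℚ_[p] → ℚ_[p]}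
    (hφ : HasWeight k φ) (hreg : IsRegular φ)
    (h : ∀ γ : GSp g ℚ, φ (mapGSp g (algebraMap ℚ ℚ_[p]) γ) = 0) : φ = 0 := by
  refine hφ.eq_zero_of_Uopp hreg fun u hu => ?_
  obtain ⟨x, hx⟩ := hφ.exists_uoppParam_eq hu
  obtain ⟨m, Q, hQ⟩ := hreg.exists_det_pow_mul
  let Θ : Matrix (Fin g) (Fin g) ℚ_[p] × Matrix (Fin g) (Fin g) ℚ_[p] → ℚ_[p] := fun x =>
    MvPolynomial.eval (fun ij : Idx g × Idx g => mat (uoppParam x) ij.1 ij.2) Q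
  have hΘ : Continuous Θ := by
    refine (MvPolynomial.continuous_eval Q).comp (continuous_pi fun ij => ?_)
    have hcont : Continuous fun x : Matrix (Fin g) (Fin g) ℚ_[p] × Matrix (Fin g) (Fin g) ℚ_[p] =>
        mat (uoppParam x) := by
      simp only [mat_uoppParam]
      have hL : Continuous fun x : Matrix (Fin g) (Fin g) ℚ_[p] × Matrix (Fin g) (Fin g) ℚ_[p] =>
          lowerUnipotent x.2 := by
        refine continuous_matrix fun i j => ?_
        simp only [lowerUnipotent, Matrix.of_apply]
        split_ifs
        · exact continuous_snd.matrix_elem i j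
        · exact continuous_const
        · exact continuous_const
      exact hL.matrix_fromBlocks continuous_const
        ((continuous_fst.add ((continuous_const.matrix_mul
          continuous_fst.matrix_transpose).matrix_mul continuous_const)).matrix_mul hL)
        ((continuous_const.matrix_mul hL.matrix_adjugate.matrix_transpose).matrix_mul
          continuous_const)
    exact hcont.matrix_elem ij.1 ij.2
  have hdense : DenseRange fun x : Matrix (Fin g) (Fin g) ℚ × Matrix (Fin g) (Fin g) ℚ =>
      (x.1.map (algebraMap ℚ ℚ_[p]), x.2.map (algebraMap ℚ ℚ_[p])) := by
    have h1 : DenseRange fun M : Matrix (Fin g) (Fin g) ℚ => M.map (algebraMap ℚ ℚ_[p]) :=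
      DenseRange.piMap fun _ => DenseRange.piMap fun _ => Padic.denseRange_ratCast p
    exact h1.prodMap h1
  have hΘ0 : Θ = fun _ => 0 := hdense.equalizer hΘ continuous_const (funext fun y => by
    change MvPolynomial.eval _ Q = 0
    rw [← hQ, uoppParam_map, h, mul_zero])
  have h0 := hQ (uoppParam x)
  rw [show MvPolynomial.eval _ Q = Θ x from rfl, hΘ0] at h0
  rw [hx]
  exact (mul_eq_zero.mp h0).resolve_left (pow_ne_zero _ (det_mat_ne_zero _))

/-- Every regular function of weight `k` over `ℚ_p` is a linear combination of left translates of
the highest weight vector. -/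
theorem mem_hstSpan_padic {k : Fin g → ℕ} (hk : Antitone k) {φ : GSp g ℚ_[p] → ℚ_[p]}
    (hreg : IsRegular φ) (hφ : HasWeight k φ) : φ ∈ hstSpan ℚ_[p] k := by
  obtain ⟨w, hw, hwγ⟩ := exists_mem_hstSpan_eq_on_subfield (K := ℚ) hk hreg hφ
  have hwreg : IsRegular w := by
    have hle : hstSpan ℚ_[p] k ≤ (regularFunctions g ℚ_[p]).toSubmodule := by
      rw [hstSpan, Submodule.span_le]
      rintro _ ⟨a, rfl⟩
      exact isRegular_translatedHst k a
    exact hle hw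
  have h : φ - w = 0 := HasWeight.eq_zero_of_rational (k := k)
    (fun γ β hβ => by
      rw [Pi.sub_apply, Pi.sub_apply, hφ γ β hβ, hasWeight_of_mem_hstSpan hk hw γ β hβ, mul_sub])
    ((regularFunctions g ℚ_[p]).sub_mem hreg hwreg)
    fun γ => by rw [Pi.sub_apply, hwγ, sub_self]
  rw [sub_eq_zero.mp h]
  exact hw

end Padic

/-! ### Restriction to the kernel of reduction -/

section Restriction

variable {p : ℕ} [Fact p.Prime] {g : ℕ}

/-- A lower unipotent matrix over `ℚ_p` whose entries below the diagonal have norm less than one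
comes from `U^{opp}_1`. -/
lemma exists_inclUopp_eq (hg : 0 < g) {u : GSp g ℚ_[p]} (hu : u ∈ Uopp g ℚ_[p])
    (hlt : ∀ i j : Idx g, toLex j < toLex i → ‖mat u i j‖ < 1) :
    ∃ v : UoppOne p g, inclUopp v = u := by
  have hle : ∀ i j : Idx g, ‖mat u i j‖ ≤ 1 := fun i j => by
    rcases lt_trichotomy (toLex i) (toLex j) with h | h | h
    · rw [hu.1 i j h, norm_zero]; exact zero_le_one
    · rw [toLex.injective h, hu.2, norm_one]
    · exact (hlt i j h).le
  let M : Matrix (Idx g) (Idx g) ℤ_[p] := Matrix.of fun i j => ⟨mat u i j, hle i j⟩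
  have hM : M.map (algebraMap ℤ_[p] ℚ_[p]) = mat u := rfl
  have hinj : Function.Injective (algebraMap ℤ_[p] ℚ_[p]) := Subtype.val_injective
  have hdet : M.det = 1 := hinj (by
    rw [RingHom.map_det, map_one]
    exact det_of_mem_Uopp hu)
  obtain ⟨c, hc, hcu⟩ := exists_similitude u
  -- Comparing determinants gives `c ^ (2g) = 1`.
  have hcnorm : ‖c‖ = 1 := by
    have hJ : (sympMatrix g ℚ_[p]).det ≠ 0 := fun h => by
      have := congrArg Matrix.det (sympMatrix_mul_self (g := g) (K := ℚ_[p]))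
      rw [Matrix.det_mul, h, zero_mul, Matrix.det_neg, Matrix.det_one, mul_one] at this
      exact pow_ne_zero _ (neg_ne_zero.mpr one_ne_zero) this.symm
    have h := congrArg Matrix.det hcu
    rw [Matrix.det_mul, Matrix.det_mul, Matrix.det_transpose, det_of_mem_Uopp hu, one_mul,
      mul_one, Matrix.det_smul, eq_comm, mul_eq_right₀ hJ] at h
    have h' := congrArg norm h
    rw [norm_pow, norm_one] at h'
    refine (pow_eq_one_iff_of_nonneg (norm_nonneg c) ?_).mp h'
    rw [Fintype.card_sum, Fintype.card_fin]
    omega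
  let γ : GSp g ℤ_[p] := ⟨Matrix.GeneralLinearGroup.mk'' M (by rw [hdet]; exact isUnit_one),
    PadicInt.mkUnits hcnorm, by
      have hmap : ∀ A B : Matrix (Idx g) (Idx g) ℤ_[p],
          A.map (algebraMap ℤ_[p] ℚ_[p]) = B.map (algebraMap ℤ_[p] ℚ_[p]) → A = B :=
        fun A B h => Matrix.map_injective hinj h
      apply hmap
      change (Mᵀ * sympMatrix g ℤ_[p] * M).map (algebraMap ℤ_[p] ℚ_[p]) = _
      rw [Matrix.map_mul, Matrix.map_mul, Matrix.transpose_map, hM, map_sympMatrix, hcu,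
        ← map_sympMatrix (algebraMap ℤ_[p] ℚ_[p])]
      ext i j
      simp only [Matrix.smul_apply, Matrix.map_apply, smul_eq_mul, map_mul]
      rfl⟩
  have hγ : mat γ = M := rfl
  refine ⟨⟨γ, ⟨fun i j hij => hinj ?_, fun i => hinj ?_⟩, ?_⟩, ?_⟩
  · rw [map_zero]; exact hu.1 i j hij
  · rw [map_one]; exact hu.2 i
  · refine Subtype.ext (Units.ext ?_)
    ext i j
    change PadicInt.toZMod (M i j) = (1 : Matrix (Idx g) (Idx g) (ZMod p)) i j
    rcases lt_trichotomy (toLex i) (toLex j) with h | h | h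
    · have h0 : M i j = 0 := hinj (by rw [map_zero]; exact hu.1 i j h)
      rw [h0, map_zero, Matrix.one_apply_ne]
      rintro rfl; exact lt_irrefl _ h
    · obtain rfl := toLex.injective h
      have h1 : M i i = 1 := hinj (by rw [map_one]; exact hu.2 i)
      rw [h1, map_one, Matrix.one_apply_eq]
    · rw [Matrix.one_apply_ne (by rintro rfl; exact lt_irrefl _ h), ← RingHom.mem_ker,
        PadicInt.ker_toZMod, PadicInt.maximalIdeal_eq_span_p, Ideal.mem_span_singleton,
        ← PadicInt.norm_lt_one_iff_dvd]
      exact hlt i j h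
  · exact mat_injective rfl

/-- Functions of weight `k` are determined by their values on `U^{opp}_1`, since the torus
contracts all of `U^{opp}` into this subgroup. -/
lemma HasWeight.eq_zero_of_UoppOne (hg : 0 < g) {k : Fin g → ℕ} {φ : GSp g ℚ_[p] → ℚ_[p]}
    (hφ : HasWeight k φ) (hreg : IsRegular φ) (h : ∀ v : UoppOne p g, φ (inclUopp v) = 0) :
    φ = 0 := by
  refine hφ.eq_zero_of_Uopp hreg fun u hu => ?_
  refine hreg.eq_zero_of_curve (contraction u) ?_ u 1 (contraction_eval_one u).symm
  -- The parameters `s = p ^ (n + m)` with `n` large move `u` into `U^{opp}_1`.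
  let b : ℝ := 1 + ∑ i, ∑ j, ‖mat u i j‖
  have hb : ∀ i j, ‖mat u i j‖ ≤ b := fun i j => by
    have h1 : ‖mat u i j‖ ≤ ∑ j, ‖mat u i j‖ :=
      Finset.single_le_sum (f := fun j => ‖mat u i j‖) (fun _ _ => norm_nonneg _)
        (Finset.mem_univ j)
    have h2 : ∑ j, ‖mat u i j‖ ≤ ∑ i, ∑ j, ‖mat u i j‖ :=
      Finset.single_le_sum (f := fun i => ∑ j, ‖mat u i j‖)
        (fun _ _ => Finset.sum_nonneg fun _ _ => norm_nonneg _) (Finset.mem_univ i)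
    simp only [b]
    linarith
  have hb0 : 0 < b := by
    have : 0 ≤ ∑ i, ∑ j, ‖mat u i j‖ :=
      Finset.sum_nonneg fun _ _ => Finset.sum_nonneg fun _ _ => norm_nonneg _
    simp only [b]
    linarith
  obtain ⟨n, hn⟩ := exists_pow_lt_of_lt_one (inv_pos.mpr hb0) (Padic.norm_p_lt_one (p := p))
  have hp := Fact.out (p := p.Prime)
  refine Set.infinite_of_injective_forall_mem (f := fun m : ℕ => ((p ^ (n + m) : ℕ) : ℚ_[p]))
    (fun a b hab => ?_) fun m => ?_
  · have := Nat.pow_right_injective hp.two_le (Nat.cast_injective hab)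
    omega
  · set s : ℚ_[p] := ((p ^ (n + m) : ℕ) : ℚ_[p]) with hs
    have hs0 : s ≠ 0 := Nat.cast_ne_zero.mpr (pow_ne_zero _ hp.ne_zero)
    have hp1 : ‖(p : ℚ_[p])‖ ≤ 1 := Padic.norm_p_lt_one.le
    have hsn : ‖s‖ < b⁻¹ := by
      rw [hs, Nat.cast_pow, norm_pow]
      exact (pow_le_pow_of_le_one (norm_nonneg _) hp1 (Nat.le_add_right n m)).trans_lt hn
    have hs1 : ‖s‖ ≤ 1 := by
      rw [hs, Nat.cast_pow, norm_pow]
      exact pow_le_one₀ (norm_nonneg _) hp1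
    have hmat := mat_torus_conj hu s hs0
    have hentry : ∀ i j, mat (torus g s hs0 * u * (torus g s hs0)⁻¹) i j =
        mat u i j * s ^ (position i - position j) := fun i j => by
      rw [hmat]
      simp [contraction]
    obtain ⟨v, hv⟩ := exists_inclUopp_eq hg (u := torus g s hs0 * u * (torus g s hs0)⁻¹)
      ⟨fun i j hij => by rw [hentry, hu.1 i j hij, zero_mul],
        fun i => by rw [hentry, hu.2, Nat.sub_self, pow_zero, one_mul]⟩ fun i j hij => by
        rw [hentry, norm_mul, norm_pow]
        have hk := Nat.sub_ne_zero_of_lt (position_lt_of_toLex_lt hij)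
        calc ‖mat u i j‖ * ‖s‖ ^ (position i - position j) ≤ b * ‖s‖ :=
              mul_le_mul (hb i j) (pow_le_of_le_one (norm_nonneg _) hs1 hk)
                (pow_nonneg (norm_nonneg _) _) hb0.le
          _ < b * b⁻¹ := mul_lt_mul_of_pos_left hsn hb0
          _ = 1 := mul_inv_cancel₀ hb0.ne'
    exact ⟨inclUopp v, by rw [hv, hmat], h v⟩

lemma restrictUopp_injective (hg : 0 < g) (k : Fin g → ℕ) :
    Function.Injective (restrictUopp p g k) := by
  rw [← LinearMap.ker_eq_bot, LinearMap.ker_eq_bot']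
  intro φ hφ
  exact Subtype.ext (HasWeight.eq_zero_of_UoppOne hg φ.2.2 φ.2.1 fun v => congrFun hφ v)

lemma integralUopp_restrictUopp (hg : 0 < g) {k : Fin g → ℕ} (μ : algRepDual p g k)
    (φ : algRep p g k) : integralUopp μ (restrictUopp p g k φ) = μ φ := by
  have h : ∃ ψ : algRep p g k, restrictUopp p g k ψ = restrictUopp p g k φ := ⟨φ, rfl⟩
  rw [integralUopp, dif_pos h, restrictUopp_injective hg k h.choose_spec]

end Restriction

/-! ### The pairing -/

section Pairing

variable {p : ℕ} [Fact p.Prime] {g : ℕ}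

variable (p g) in
/-- The twisting matrix `diag(1, p⁻¹)` as a symplectic similitude. -/
noncomputable def twistGSp : GSp g ℚ_[p] :=
  mkGSp (twistMatrix p g) (p : ℚ_[p])⁻¹
    (inv_ne_zero (Nat.cast_ne_zero.mpr (Fact.out (p := p.Prime)).ne_zero)) (by
    rw [twistMatrix, sympMatrix, Matrix.fromBlocks_transpose, Matrix.fromBlocks_multiply,
      Matrix.fromBlocks_multiply, Matrix.fromBlocks_smul]
    simp)

lemma transposeGSp_twistGSp : transposeGSp (twistGSp p g) = twistGSp p g :=
  mat_injective (by
    simp [twistGSp, twistMatrix, Matrix.fromBlocks_transpose])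

/-- The left translate of the highest weight vector as an element of the representation. -/
noncomputable def hstVector {k : Fin g → ℕ} (hk : Antitone k) (h : GSp g ℚ_[p]) : algRep p g k :=
  ⟨translatedHst k h, isRegular_translatedHst k h, hasWeight_translatedHst hk h⟩

lemma span_hstVector {k : Fin g → ℕ} (hk : Antitone k) :
    Submodule.span ℚ_[p] (Set.range (hstVector (p := p) hk)) = ⊤ := by
  rw [eq_top_iff]
  intro φ _
  have h := mem_hstSpan_padic hk φ.2.1 φ.2.2
  have h' : hstSpan ℚ_[p] k =
      (Submodule.span ℚ_[p] (Set.range (hstVector (p := p) hk))).map (algRep p g k).subtype := by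
    rw [Submodule.map_span, ← Set.range_comp]
    rfl
  rw [h'] at h
  obtain ⟨ψ, hψ, hψφ⟩ := h
  rwa [← Subtype.ext hψφ]

lemma eq_zero_of_hstVector {k : Fin g → ℕ} (hk : Antitone k) (μ : algRepDual p g k)
    (h : ∀ γ, μ (hstVector hk γ) = 0) : μ = 0 :=
  LinearMap.ext_on_range (span_hstVector hk) fun γ => by rw [h, LinearMap.zero_apply]

lemma isRegular_comp_of_coord {K : Type*} [Field K] {φ : GSp g K → K} (hφ : IsRegular φ)
    (f : GSp g K → GSp g K) (hf : ∀ a, (fun γ => coord (f γ) a) ∈ regularFunctions g K) :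
    IsRegular fun γ => φ (f γ) := by
  obtain ⟨d, F, rfl⟩ := hφ.exists_tensorEval
  exact sum_mem_regularFunctions _ _ fun s _ => mul_mem_regularFunctions
    (const_mem_regularFunctions _) (prod_mem_regularFunctions _ _ fun i _ => hf _)

lemma isRegular_comp_transpose_mul {K : Type*} [Field K] {φ : GSp g K → K} (hφ : IsRegular φ)
    (h : GSp g K) : IsRegular fun γ => φ (transposeGSp γ * h) := by
  refine isRegular_comp_of_coord hφ _ ?_
  rintro (- | ⟨⟨i, j⟩ | u⟩)
  · exact const_mem_regularFunctions 1
  · simp only [coord, mat_mul, mat_transposeGSp, Matrix.mul_apply, Matrix.transpose_apply]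
    exact sum_mem_regularFunctions _ _ fun c _ => mul_mem_regularFunctions
      (entry_mem_regularFunctions _ _) (const_mem_regularFunctions _)
  · simp only [coord, mat_mul, mat_transposeGSp, Matrix.det_mul, Matrix.det_transpose, mul_inv]
    exact mul_mem_regularFunctions det_inv_mem_regularFunctions (const_mem_regularFunctions _)

/-- Matrix coefficients `h ↦ μ(e_k(h ·))` are regular: after extending `μ` to tensors, they
are linear combinations of the components of the translates of one tensor. -/
lemma isRegular_apply_hstVector {k : Fin g → ℕ} (hk : Antitone k) (μ : algRepDual p g k) :
    IsRegular fun h => μ (hstVector hk h) := by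
  obtain ⟨d, E, hE⟩ := (isRegular_translatedHst (K := ℚ_[p]) k 1).exists_tensorEval
  have htr : ∀ h, tensorEval d (translate h E) = translatedHst k h := fun h => by
    ext γ
    rw [tensorEval_translate, hE, translatedHst, one_mul]
    rfl
  let T : Submodule ℚ_[p] (Tensor g ℚ_[p] d) := (algRep p g k).comap (tensorEval d)
  let ev : T →ₗ[ℚ_[p]] algRep p g k :=
    ((tensorEval d).comp T.subtype).codRestrict _ fun F => F.2
  obtain ⟨ν, hν⟩ := LinearMap.exists_extend (μ.comp ev)
  have hμ : ∀ h, μ (hstVector hk h) = ν (translate h E) := fun h => by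
    have hmem : translate h E ∈ T := by
      rw [Submodule.mem_comap, htr]
      exact (hstVector hk h).2
    have h1 := LinearMap.congr_fun hν ⟨translate h E, hmem⟩
    have h2 : ev ⟨translate h E, hmem⟩ = hstVector hk h := Subtype.ext (htr h)
    rw [LinearMap.comp_apply, LinearMap.comp_apply, h2] at h1
    exact h1.symm
  have hsum : (fun h => μ (hstVector hk h)) = fun h => ∑ s, (∑ t, E t *
      ∏ i, coordMat h (t i) (s i)) * ν fun r => if s = r then 1 else 0 := funext fun h => by
    rw [hμ, LinearMap.pi_apply_eq_sum_univ ν]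
    rfl
  rw [hsum]
  exact sum_mem_regularFunctions _ _ fun s _ => mul_mem_regularFunctions
    (sum_mem_regularFunctions _ _ fun t _ => mul_mem_regularFunctions
      (const_mem_regularFunctions _)
      (prod_mem_regularFunctions _ _ fun i _ => coordMat_mem_regularFunctions _ _))
    (const_mem_regularFunctions _)

lemma hstVector_transpose_mul {k : Fin g → ℕ} (hk : Antitone k) {β : GSp g ℚ_[p]}
    (hβ : β ∈ Borel g ℚ_[p]) (h : GSp g ℚ_[p]) :
    hstVector hk (transposeGSp β * h) = weightChar k β • hstVector hk h := by
  ext γ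
  change eHst k (mat (transposeGSp β * h * γ)) = weightChar k β * eHst k (mat (h * γ))
  rw [mul_assoc, mat_mul, ← eHst_transpose, Matrix.transpose_mul, mat_transposeGSp,
    Matrix.transpose_transpose, eHst_mul_of_mem_borel hk _ hβ, eHst_transpose]

/-- The map from the dual representation to the representation that sends `μ` to the
function `γ ↦ μ(e_k(γᵀ diag(1, p⁻¹) ·))`. -/
noncomputable def dualToRep {k : Fin g → ℕ} (hk : Antitone k) :
    algRepDual p g k →ₗ[ℚ_[p]] algRep p g k where
  toFun μ := ⟨fun γ => μ (hstVector hk (transposeGSp γ * twistGSp p g)),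
    isRegular_comp_transpose_mul (isRegular_apply_hstVector hk μ) _, fun γ β hβ => by
      change μ (hstVector hk (transposeGSp (γ * β) * twistGSp p g)) =
        weightChar k β * μ (hstVector hk (transposeGSp γ * twistGSp p g))
      rw [transposeGSp_mul, mul_assoc, hstVector_transpose_mul hk hβ, map_smul, smul_eq_mul]⟩
  map_add' _ _ := rfl
  map_smul' _ _ := rfl

lemma dualToRep_apply {k : Fin g → ℕ} (hk : Antitone k) (μ : algRepDual p g k)
    (γ : GSp g ℚ_[p]) :
    (dualToRep hk μ).1 γ = μ (hstVector hk (transposeGSp γ * twistGSp p g)) := rfl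

/-- The symmetry of the kernel: the image of an evaluation functional is a translate of the
highest weight vector. -/
lemma dualToRep_evaluation {k : Fin g → ℕ} (hk : Antitone k) (x : GSp g ℚ_[p]) :
    dualToRep hk ((LinearMap.proj x).comp (algRep p g k).subtype) =
      hstVector hk (transposeGSp x * twistGSp p g) := by
  ext γ
  change eHst k (mat (transposeGSp γ * twistGSp p g * x)) =
    eHst k (mat (transposeGSp x * twistGSp p g * γ))
  rw [← eHst_transpose, ← mat_transposeGSp, transposeGSp_mul, transposeGSp_mul,
    transposeGSp_twistGSp, transposeGSp_transposeGSp, mul_assoc]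

lemma eq_zero_of_hstVector_transpose_mul_twist {k : Fin g → ℕ} (hk : Antitone k)
    (μ : algRepDual p g k) (h : ∀ γ, μ (hstVector hk (transposeGSp γ * twistGSp p g)) = 0) :
    μ = 0 :=
  eq_zero_of_hstVector hk μ fun γ => by
    have h1 := h (transposeGSp (γ * (twistGSp p g)⁻¹))
    rwa [transposeGSp_transposeGSp, inv_mul_cancel_right] at h1

lemma restrictUopp_hstVector {k : Fin g → ℕ} (hk : Antitone k) (u₂ : UoppOne p g) :
    restrictUopp p g k (hstVector hk (transposeGSp (inclUopp u₂) * twistGSp p g)) =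
      fun u₁ => pairingKernel p g k u₂ u₁ := rfl

lemma restrictUopp_dualToRep (hg : 0 < g) {k : Fin g → ℕ} (hk : Antitone k)
    (μ : algRepDual p g k) :
    restrictUopp p g k (dualToRep hk μ) =
      fun u₂ => integralUopp μ fun u₁ => pairingKernel p g k u₂ u₁ := by
  funext u₂
  rw [← restrictUopp_hstVector hk, integralUopp_restrictUopp hg]
  rfl

lemma algPairing_eq (hg : 0 < g) {k : Fin g → ℕ} (hk : Antitone k) (μ₁ μ₂ : algRepDual p g k) :
    algPairing μ₁ μ₂ = μ₂ (dualToRep hk μ₁) := by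
  rw [algPairing, ← restrictUopp_dualToRep hg hk, integralUopp_restrictUopp hg]

end Pairing
end SymplecticPairing

theorem mainTheorem9 (p : ℕ) [Fact p.Prime] (g : ℕ) (hg : 0 < g) (k : Fin g → ℕ)
    (hpos : ∀ i, 0 < k i) (hdom : Antitone k) :
    -- the integrals are well defined: the integrands are restrictions of unique elements
    Function.Injective (restrictUopp p g k) ∧
    (∀ u₂ : UoppOne p g, ∃ φ : algRep p g k,
      restrictUopp p g k φ = fun u₁ => pairingKernel p g k u₂ u₁) ∧
    (∀ μ₁ : algRepDual p g k, ∃ φ : algRep p g k,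
      restrictUopp p g k φ =
        fun u₂ => integralUopp μ₁ fun u₁ => pairingKernel p g k u₂ u₁) ∧
    -- the pairing is bilinear and non-degenerate
    ∃ B : algRepDual p g k →ₗ[ℚ_[p]] algRepDual p g k →ₗ[ℚ_[p]] ℚ_[p],
      (∀ μ₁ μ₂, B μ₁ μ₂ = algPairing μ₁ μ₂) ∧ B.Nondegenerate := by
  refine ⟨restrictUopp_injective hg k, fun u₂ => ⟨_, restrictUopp_hstVector hdom u₂⟩,
    fun μ₁ => ⟨_, restrictUopp_dualToRep hg hdom μ₁⟩,
    (Module.Dual.eval ℚ_[p] (algRep p g k)).comp (dualToRep hdom),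
    fun μ₁ μ₂ => (algPairing_eq hg hdom μ₁ μ₂).symm, fun μ₁ h => ?_, fun μ₂ h => ?_⟩
  · have h0 : dualToRep hdom μ₁ = 0 :=
      (Module.forall_dual_apply_eq_zero_iff ℚ_[p] _).mp fun μ₂ => h μ₂
    refine eq_zero_of_hstVector_transpose_mul_twist hdom μ₁ fun γ => ?_
    rw [← dualToRep_apply, h0]
    rfl
  · refine eq_zero_of_hstVector_transpose_mul_twist hdom μ₂ fun γ => ?_
    rw [← dualToRep_evaluation]
    exact h _
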